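/- Fix $m\ge 0$ colors $1,\dots,m$ and a finite collection $\mathcal G$ of colored chains $g=(i_1\prec\cdots\prec i_\ell)$, with all $\ell\ge 2$ and all $i_j\in\{1,\dots,m\}$. A colored subset of a finite poset $P$ is a subset $S\subseteq P$ with a coloring $c:S\to\{1,\dots,m\}$; it is valid if there is no $g=(i_1\prec\cdots\prec i_\ell)\in\mathcal G$ for which there are $x_1<\cdots<x_\ell$ in $S$ with $c(x_j)=i_j$ for all $j$. A template on $P$ is a function $T:P\to\mathcal P(\{1,\dots,m\})$; it is valid if every coloring $c$ of its support $\{x: T(x)\ne\emptyset\}$ with $c(x)\in T(x)$ for all $x$ is valid. Suppose that $\mathcal G$ is sparse, i.e. that for every color $i$ it contains a monochromatic chain $(i\prec\cdots\prec i)$. Let $\overline p=(p_1,\dots,p_m)$ with $p_i\ge 0$ and $\sum_i p_i\le 1$, and put $$\omega_{crit}(\overline p)=\max_T\ \sum_{x}\log\Bigl(1+\sum_{i\in T(x)}p_i\Bigr),$$ where $T$ ranges over all valid templates on finite chain posets (totally ordered sets of any finite size) and $x$ ranges over the elements of the chain poset. **Theorem.** The maximum defining $\omega_{crit}(\overline p)$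 is attained. Color each element of $(\mathcal P([n]),\subseteq)$ independently with color $i$ with probability $p_i$, and leave it uncolored with probability $1-\sum_i p_i$. Let $V$ be the number of subsets $S\subseteq\mathcal P([n])$ all of whose elements are colored and which are valid with the colors they receive. Then, as $n\to\infty$ with $m,\mathcal G,\overline p$ fixed, $$\mathbb E(V)=e^{\omega_{crit}(\overline p)\binom{n}{\lfloor n/2\rfloor}(1+o(1))}.$$ -/

import Mathlib

open MeasureTheory ProbabilityTheory Filter Topology

namespace ColoredChains

/-- A colored subset of `P` with colors `Fin m` is a partial function from `P` to `Fin m`: the value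
`none` means that the point is not in the subset, and `some i` that it is in it and has color `i`. -/
abbrev ColoredSubset (P : Type*) (m : ℕ) : Type _ := P → Option (Fin m)

/-- The colored chain poset `i₁ ≺ ⋯ ≺ i_ℓ`, given by the list `g = [i₁, …, i_ℓ]` of its colors from
bottom to top, appears in the colored subset `c` as a colored subchain: there are
`x₁ < ⋯ < x_ℓ` in the subset such that `x_j` has color `i_j`. -/
def Appears {P : Type*} [Preorder P] {m : ℕ} (g : List (Fin m)) (c : ColoredSubset P m) : Prop :=
  ∃ x : Fin g.length → P, StrictMono x ∧ ∀ j, c (x j) = some (g.get j)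

/-- `c` avoids all colored chains from `G`. -/
def IsValid {P : Type*} [Preorder P] {m : ℕ} (G : Finset (List (Fin m)))
    (c : ColoredSubset P m) : Prop :=
  ∀ g ∈ G, ¬ Appears g c

/-- `G` contains a monochromatic chain of every color. -/
def IsSparse {m : ℕ} (G : Finset (List (Fin m))) : Prop :=
  ∀ i : Fin m, ∃ l : ℕ, List.replicate l i ∈ G

/-- A template on `P` assigns to every point a set of colors. -/
abbrev Template (P : Type*) (m : ℕ) : Type _ := P → Finset (Fin m)

/-- `c` is a coloring of the support `{x | T x ≠ ∅}` of `T` which assigns to each point `x` of the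
support an element of `T x` (and points outside the support are not in the subset). -/
def Template.IsColoringOfSupport {P : Type*} {m : ℕ} (T : Template P m)
    (c : ColoredSubset P m) : Prop :=
  ∀ x, (T x = ∅ → c x = none) ∧ (T x ≠ ∅ → ∃ i ∈ T x, c x = some i)

/-- A template is valid if every coloring of its support by allowed colors is valid. -/
def Template.IsValid {P : Type*} [Preorder P] {m : ℕ} (G : Finset (List (Fin m)))
    (T : Template P m) : Prop :=
  ∀ c : ColoredSubset P m, T.IsColoringOfSupport c → ColoredChains.IsValid G c

/-- The weight `∑ₓ log (1 + ∑_{i ∈ T x} βᵢ)` of a template. -/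
noncomputable def Template.weight {P : Type*} [Fintype P] {m : ℕ} (β : Fin m → ℝ)
    (T : Template P m) : ℝ :=
  ∑ x, Real.log (1 + ∑ i ∈ T x, β i)

/-- The weights of all valid templates on finite chain posets. -/
def chainWeights {m : ℕ} (G : Finset (List (Fin m))) (β : Fin m → ℝ) : Set ℝ :=
  {w | ∃ (l : ℕ) (T : Template (Fin l) m), T.IsValid G ∧ T.weight β = w}

/-- The critical weight: the maximum of `chainWeights G β`. -/
noncomputable def omegaCrit {m : ℕ} (G : Finset (List (Fin m))) (β : Fin m → ℝ) : ℝ :=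
  sSup (chainWeights G β)

open Classical in
/-- The set `S` with the colors that it inherits from the partial coloring `χ`. -/
noncomputable def restrict {P : Type*} {m : ℕ} (χ : P → Option (Fin m)) (S : Set P) :
    ColoredSubset P m :=
  fun x => if x ∈ S then χ x else none

/-- The number of validly colored subsets of `P` under the partial coloring `χ`: the number of sets
`S`, all of whose points are colored, such that `S` with the inherited colors is valid. -/
noncomputable def numValid {P : Type*} [Preorder P] {m : ℕ} (G : Finset (List (Fin m)))
    (χ : P → Option (Fin m)) : ℕ :=
  Set.ncard {S : Set P | (∀ x ∈ S, χ x ≠ none) ∧ IsValid G (restrict χ S)}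

/-- `χ` is a random partial coloring of `P`: independently for all `x`, the point `x` gets color `i`
with probability `p i` (and so stays uncolored with probability `1 - ∑ i, p i`). Here
`Option (Fin m)` carries the discrete σ-algebra. -/
structure IsRandomColoring {P Ω : Type*} [MeasurableSpace Ω] {m : ℕ} (p : Fin m → ℝ)
    (μ : Measure Ω) (χ : P → Ω → Option (Fin m)) : Prop where
  measurable : ∀ x, Measurable[_, ⊤] (χ x)
  indep : iIndepFun (m := fun _ => ⊤) χ μ
  prob : ∀ x i, μ {ω | χ x ω = some i} = ENNReal.ofReal (p i)

end ColoredChains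

namespace ColoredChains

/-! ### Templates on chains; the maximum is attained -/

section Chains

variable {P : Type*} {m : ℕ} {G : Finset (List (Fin m))}

/-! By linearity and independence, `integral_numValid` turns the expectation into `partitionSum`,
the weighted count of valid colored subsets. It remains to find the logarithm of this sum relative
to N = `n.choose (n / 2)`.

Lower bound: an optimal chain template is placed on consecutive layers from the middle upwards. It
stays valid, and each of these boundedly many layers has size (1 + o(1)) N.

Upper bound: each point of a valid colored subset is labelled by its color and the relevant words
readable strictly above it. Labels of comparable points then satisfy the binary relation
`Compatible`; conversely, pairwise compatibility excludes every forbidden chain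
(`isValid_colorsOf`). Valid colored subsets thus become independent sets of a digraph, and the graph
container lemma `exists_container` covers them by few label sets of outdegree below d.

To bound the weight of a container, take a random maximal chain of the cube. Given a point of size
at most 3n/4 on it, a prescribed larger set other than the top lies on it with probability at most
4/n. Containers therefore have O(d/n) conflicts on average along the chain; deleting these leaves a
valid template of weight at most `omegaCrit`. Double counting (`factorial_mul_sum_le`) gives total
weight at most N (`omegaCrit` + O(d/n)). With d about n^(3/4), the number of containers is also
exp(o(N)). -/

theorem exists_strictMono_iff_exists_list [Preorder P] {α : Type*} (r : P → α → Prop)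
    (g : List α) :
    (∃ x : Fin g.length → P, StrictMono x ∧ ∀ j, r (x j) (g.get j)) ↔
      ∃ l : List P, l.IsChain (· < ·) ∧ List.Forall₂ r l g := by
  constructor
  · rintro ⟨x, hx, hr⟩
    refine ⟨List.ofFn x, (List.sortedLT_ofFn_iff.2 hx).isChain, ?_⟩
    rw [List.forall₂_iff_get]
    refine ⟨by simp, fun i h₁ h₂ => ?_⟩
    simpa using hr ⟨i, h₂⟩
  · rintro ⟨l, hl, hr⟩
    have hlen := hr.length_eq
    refine ⟨fun j => l.get (j.cast hlen.symm), ?_, ?_⟩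
    · intro i j hij
      exact (List.sortedLT_iff_isChain.2 hl).strictMono_get (by simpa using hij)
    · intro j
      exact (List.forall₂_iff_get.1 hr).2 j (by simp [hlen]) j.2

theorem appears_iff [Preorder P] {g : List (Fin m)} {c : ColoredSubset P m} :
    Appears g c ↔
      ∃ l : List P, l.IsChain (· < ·) ∧ List.Forall₂ (fun x i => c x = some i) l g :=
  exists_strictMono_iff_exists_list (fun x i => c x = some i) g

/-- Points of a strict chain are distinct, so colors can be chosen on them independently and the
choice extends to the whole support. -/
theorem Template.isValid_iff [Preorder P] {T : Template P m} :
    T.IsValid G ↔ ∀ g ∈ G, ¬ ∃ x : Fin g.length → P, StrictMono x ∧ ∀ j, g.get j ∈ T (x j) := by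
  classical
  constructor
  · rintro h g hg ⟨x, hx, hT⟩
    let c : ColoredSubset P m := fun y =>
      if hy : ∃ j, x j = y then some (g.get hy.choose)
      else if hy : (T y).Nonempty then some hy.choose else none
    refine h c ?_ g hg ⟨x, hx, fun j => ?_⟩
    · intro y
      by_cases hy : ∃ j, x j = y
      · have hmem : g.get hy.choose ∈ T y := by
          have := hT hy.choose
          rwa [hy.choose_spec] at this
        refine ⟨fun he => ?_, fun _ => ⟨_, hmem, by simp [c, hy]⟩⟩
        rw [he] at hmem
        simp at hmem
      · refine ⟨fun he => by simp [c, hy, he], fun hne => ?_⟩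
        have hne' := Finset.nonempty_iff_ne_empty.2 hne
        exact ⟨_, hne'.choose_spec, by simp [c, hy, hne']⟩
    · have hj : ∃ k, x k = x j := ⟨j, rfl⟩
      have : hj.choose = j := hx.injective hj.choose_spec
      simp only [c, hj, dif_pos, this]
  · rintro h c hc g hg ⟨x, hx, hcx⟩
    refine h g hg ⟨x, hx, fun j => ?_⟩
    by_cases hT : T (x j) = ∅
    · have := (hc (x j)).1 hT
      simp [hcx j] at this
    · obtain ⟨i, hi, hci⟩ := (hc (x j)).2 hT
      rw [hcx j, Option.some_inj] at hci
      rwa [hci]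

theorem Template.isValid_iff_list [Preorder P] {T : Template P m} :
    T.IsValid G ↔ ∀ g ∈ G, ∀ l : List P, l.IsChain (· < ·) →
      ¬ List.Forall₂ (fun x i => i ∈ T x) l g := by
  rw [Template.isValid_iff]
  refine forall₂_congr fun g _ => ?_
  rw [exists_strictMono_iff_exists_list (fun x i => i ∈ T x) g]
  simp only [not_exists, not_and]

theorem Template.IsValid.comp [Preorder P] {Q : Type*} [Preorder Q] {T : Template P m}
    (hT : T.IsValid G) {e : Q → P} (he : StrictMono e) :
    Template.IsValid G (fun y => T (e y)) := by
  rw [Template.isValid_iff] at hT ⊢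
  rintro g hg ⟨x, hx, hxT⟩
  exact hT g hg ⟨e ∘ x, he.comp hx, hxT⟩

theorem Template.IsValid.isValid_of_forall_mem [Preorder P] {T : Template P m}
    (hT : T.IsValid G) {c : ColoredSubset P m} (hc : ∀ x i, c x = some i → i ∈ T x) :
    ColoredChains.IsValid G c := by
  rw [Template.isValid_iff] at hT
  rintro g hg ⟨x, hx, hcx⟩
  exact hT g hg ⟨x, hx, fun j => hc _ _ (hcx j)⟩

/-- A finite chain in a partial order is the image of a strictly monotone map from `Fin`. -/
theorem exists_strictMono_image_eq [PartialOrder P] [DecidableEq P] (C : Finset P)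
    (hC : IsChain (· ≤ ·) (C : Set P)) :
    ∃ e : Fin C.card → P, StrictMono e ∧ Finset.univ.image e = C := by
  -- Enumerate along a linear extension; it agrees with the given order on the chain.
  let C' : Finset (LinearExtension P) := C
  let e' : Fin C.card ↪o LinearExtension P := C'.orderEmbOfFin rfl
  have hmem (i) : (show P from e' i) ∈ C := C'.orderEmbOfFin_mem rfl i
  refine ⟨fun i => e' i, fun i j hij => ?_, ?_⟩
  · have hlt : e' i < e' j := e'.strictMono hij
    rcases hC.total (hmem i) (hmem j) with h | h
    · exact lt_of_le_of_ne h (fun h' => hlt.ne h')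
    · exact absurd (toLinearExtension.monotone h) (not_le.2 hlt)
  · ext y
    have := C'.range_orderEmbOfFin rfl
    have hy : (y : LinearExtension P) ∈ Set.range e' ↔ y ∈ C := by
      rw [show Set.range e' = (C' : Set (LinearExtension P)) from this]
      rfl
    constructor
    · intro h
      obtain ⟨i, -, h⟩ := Finset.mem_image.1 h
      exact hy.1 ⟨i, h⟩
    · intro h
      obtain ⟨i, h⟩ := hy.2 h
      exact Finset.mem_image.2 ⟨i, Finset.mem_univ _, h⟩

/-- A bound for the size of the support of a valid template on a chain. -/
noncomputable def chainBound (h : IsSparse G) : ℕ := ∑ i, (h i).choose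

/-- The forbidden monochromatic chain of color i limits the number of points of a chain that allow
i; sum over the colors. -/
theorem card_le_chainBound [PartialOrder P] (h : IsSparse G) {T : Template P m}
    (hT : T.IsValid G) (C : Finset P) (hC : IsChain (· ≤ ·) (C : Set P))
    (hne : ∀ x ∈ C, T x ≠ ∅) : C.card ≤ chainBound h := by
  classical
  have hsub : C ⊆ Finset.univ.biUnion fun i => C.filter fun x => i ∈ T x := by
    intro x hx
    obtain ⟨i, hi⟩ := Finset.nonempty_iff_ne_empty.2 (hne x hx)
    simp only [Finset.mem_biUnion, Finset.mem_univ, true_and, Finset.mem_filter]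
    exact ⟨i, hx, hi⟩
  refine (Finset.card_le_card hsub).trans (Finset.card_biUnion_le.trans ?_)
  refine Finset.sum_le_sum fun i _ => ?_
  by_contra! hlt
  obtain ⟨e, he, him⟩ := exists_strictMono_image_eq (C.filter fun x => i ∈ T x)
    (hC.mono fun x hx => (Finset.mem_filter.1 hx).1)
  rw [Template.isValid_iff] at hT
  refine hT _ (h i).choose_spec ⟨fun j => e (Fin.castLE (by simpa using hlt.le) j), ?_, ?_⟩
  · exact he.comp (Fin.strictMono_castLE _)
  · intro j
    have hmem (k) : e k ∈ C.filter fun x => i ∈ T x :=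
      him.le (Finset.mem_image_of_mem e (Finset.mem_univ k))
    simpa using (Finset.mem_filter.1 (hmem _)).2

theorem sum_log_mem_chainWeights [PartialOrder P] (β : Fin m → ℝ) {T : Template P m}
    (hT : T.IsValid G) (C : Finset P) (hC : IsChain (· ≤ ·) (C : Set P)) :
    ∑ x ∈ C, Real.log (1 + ∑ i ∈ T x, β i) ∈ chainWeights G β := by
  classical
  obtain ⟨e, he, him⟩ := exists_strictMono_image_eq C hC
  refine ⟨C.card, fun y => T (e y), hT.comp he, ?_⟩
  rw [Template.weight]
  conv_rhs => rw [← him]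
  rw [Finset.sum_image he.injective.injOn]

/-- Points with no allowed color contribute log 1 = 0. Deleting them bounds the length of the chain,
which leaves finitely many templates. -/
theorem finite_chainWeights (h : IsSparse G) (β : Fin m → ℝ) : (chainWeights G β).Finite := by
  classical
  have hfin : (⋃ l ∈ Finset.range (chainBound h + 1),
      Set.range fun T : Template (Fin l) m => T.weight β).Finite :=
    Set.Finite.biUnion (Finset.finite_toSet _) fun _ _ => Set.finite_range _
  refine hfin.subset ?_
  rintro w ⟨l, T, hT, rfl⟩
  let C : Finset (Fin l) := Finset.univ.filter fun x => T x ≠ ∅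
  have hC : IsChain (· ≤ ·) (C : Set (Fin l)) := fun x _ y _ _ => le_total x y
  have hcard := card_le_chainBound h hT C hC fun x hx => (Finset.mem_filter.1 hx).2
  obtain ⟨e, he, him⟩ := exists_strictMono_image_eq C hC
  simp only [Set.mem_iUnion, Set.mem_range, Finset.mem_range]
  refine ⟨C.card, by omega, fun y => T (e y), ?_⟩
  have h₁ : ∑ x ∈ C, Real.log (1 + ∑ i ∈ T x, β i) = T.weight β := by
    rw [Template.weight]
    refine Finset.sum_subset (Finset.subset_univ _) fun x _ hx => ?_
    have : T x = ∅ := by simpa [C] using hx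
    simp [this]
  rw [← h₁, Template.weight]
  conv_rhs => rw [← him]
  rw [Finset.sum_image he.injective.injOn]

theorem isValid_of_isEmpty [IsEmpty P] [Preorder P] (hG : ∀ g ∈ G, 2 ≤ g.length)
    (T : Template P m) : T.IsValid G := by
  rw [Template.isValid_iff]
  rintro g hg ⟨x, -, -⟩
  exact IsEmpty.false (x ⟨0, by have := hG g hg; omega⟩)

theorem isGreatest_omegaCrit (hG : ∀ g ∈ G, 2 ≤ g.length) (h : IsSparse G) (β : Fin m → ℝ) :
    IsGreatest (chainWeights G β) (omegaCrit G β) := by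
  have hne : (chainWeights G β).Nonempty := ⟨_, 0, fun _ => ∅, isValid_of_isEmpty hG _, rfl⟩
  exact ⟨hne.csSup_mem (finite_chainWeights h β),
    fun w hw => le_csSup (finite_chainWeights h β).bddAbove hw⟩

end Chains

/-! ### From forbidden chains to a binary relation on states -/

section States

variable {P : Type*} {m : ℕ} {G : Finset (List (Fin m))}

/-- A state of a point of a colored subset: its color together with the words that are read along
chains strictly above the point. -/
abbrev State (m : ℕ) : Type := Fin m × Finset (List (Fin m))

open Classical in
/-- The suffixes of the words in `G`, and the empty word. -/
noncomputable def suffixes (G : Finset (List (Fin m))) : Finset (List (Fin m)) :=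
  insert [] (G.biUnion fun g => g.tails.toFinset)

theorem mem_suffixes_iff {u : List (Fin m)} : u ∈ suffixes G ↔ u = [] ∨ ∃ g ∈ G, u <:+ g := by
  simp [suffixes]

theorem nil_mem_suffixes : [] ∈ suffixes G := mem_suffixes_iff.2 (Or.inl rfl)

theorem mem_suffixes_of_cons {i : Fin m} {u : List (Fin m)} (h : i :: u ∈ suffixes G) :
    u ∈ suffixes G := by
  rw [mem_suffixes_iff] at h ⊢
  rcases h with h | ⟨g, hg, h⟩
  · simp at h
  · exact Or.inr ⟨g, hg, (List.suffix_cons i u).trans h⟩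

/-- The condition on the states `q`, `q'` of two points `x < y` of a valid colored subset. -/
def Compatible (G : Finset (List (Fin m))) (q q' : State m) : Prop :=
  [] ∈ q'.2 ∧ (∀ u ∈ q'.2, q'.1 :: u ∈ suffixes G → q'.1 :: u ∈ q.2) ∧
    ∀ u ∈ q.2, q.1 :: u ∉ G

/-- Words propagate downwards, one color per step. Closure of `suffixes G` under tails keeps every
intermediate word available. -/
theorem mem_of_isChain_compatible {q : State m} {l : List (State m)} (hl : l ≠ [])
    (hc : (q :: l).IsChain (Compatible G)) (hs : l.map Prod.fst ∈ suffixes G) :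
    l.map Prod.fst ∈ q.2 := by
  induction l generalizing q with
  | nil => exact absurd rfl hl
  | cons q' l ih =>
    rw [List.isChain_cons_cons] at hc
    refine hc.1.2.1 _ ?_ hs
    by_cases hl' : l = []
    · subst hl'
      exact hc.1.1
    · exact ih hl' hc.2 (mem_suffixes_of_cons hs)

theorem map_fst_notMem_of_isChain_compatible {l : List (State m)} (hlen : 2 ≤ l.length)
    (hc : l.IsChain (Compatible G)) : l.map Prod.fst ∉ G := by
  match l, hlen with
  | q :: q' :: l, _ =>
    intro hG
    have hs : (q' :: l).map Prod.fst ∈ suffixes G :=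
      mem_suffixes_iff.2 (Or.inr ⟨_, hG, List.suffix_cons _ _⟩)
    have := mem_of_isChain_compatible (List.cons_ne_nil _ _) hc hs
    rw [List.isChain_cons_cons] at hc
    exact hc.1.2.2 _ this hG

open Classical in
/-- The words in `suffixes G` that are read along chains strictly above `x`. -/
noncomputable def wordsAbove [Preorder P] (G : Finset (List (Fin m))) (c : ColoredSubset P m)
    (x : P) : Finset (List (Fin m)) :=
  (suffixes G).filter fun u =>
    ∃ l : List P, (x :: l).IsChain (· < ·) ∧ List.Forall₂ (fun y i => c y = some i) l u

theorem wordsAbove_subset [Preorder P] (c : ColoredSubset P m) (x : P) :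
    wordsAbove G c x ⊆ suffixes G := by
  classical
  exact Finset.filter_subset _ _

theorem compatible_wordsAbove [Preorder P] {c : ColoredSubset P m} (hc : IsValid G c) {x y : P}
    (hxy : x < y) {i j : Fin m} (hx : c x = some i) (hy : c y = some j) :
    Compatible G (i, wordsAbove G c x) (j, wordsAbove G c y) := by
  refine ⟨?_, ?_, ?_⟩
  · simp only [wordsAbove, Finset.mem_filter]
    exact ⟨nil_mem_suffixes, [], by simp, by simp⟩
  · simp only [wordsAbove, Finset.mem_filter]
    rintro u ⟨-, l, hl, hu⟩ hs
    exact ⟨hs, y :: l, List.isChain_cons_cons.2 ⟨hxy, hl⟩, List.Forall₂.cons hy hu⟩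
  · simp only [wordsAbove, Finset.mem_filter]
    rintro u ⟨-, l, hl, hu⟩ hG
    exact hc _ hG (appears_iff.2 ⟨x :: l, hl, List.Forall₂.cons hx hu⟩)

open Classical in
/-- The template of the colors of a set of points with states. -/
noncomputable def colorsOf (F : Finset (P × State m)) : Template P m :=
  fun x => Finset.univ.filter fun i => ∃ A, (x, i, A) ∈ F

theorem mem_colorsOf {F : Finset (P × State m)} {x : P} {i : Fin m} :
    i ∈ colorsOf F x ↔ ∃ A, (x, i, A) ∈ F := by
  simp [colorsOf]

/-- A point may carry several states in `F`. Any selection of them along a chain is still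
consecutively compatible, so it cannot spell a forbidden word. -/
theorem isValid_colorsOf [Preorder P] (hG : ∀ g ∈ G, 2 ≤ g.length) {F : Finset (P × State m)}
    (hF : ∀ u ∈ F, ∀ v ∈ F, u.1 < v.1 → Compatible G u.2 v.2) :
    (colorsOf F).IsValid G := by
  rw [Template.isValid_iff_list]
  intro g hg l hl hT
  have key : ∀ {l : List P} {g : List (Fin m)}, l.IsChain (· < ·) →
      List.Forall₂ (fun x i => i ∈ colorsOf F x) l g → ∃ L : List (P × State m),
        (∀ u ∈ L, u ∈ F) ∧ L.map Prod.fst = l ∧ L.map (fun u => u.2.1) = g := by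
    intro l g hl hT
    induction hT with
    | nil => exact ⟨[], by simp⟩
    | @cons x i _ _ hx _ ih =>
      obtain ⟨L, hL, h₁, h₂⟩ := ih hl.tail
      obtain ⟨A, hA⟩ := mem_colorsOf.1 hx
      refine ⟨(x, i, A) :: L, fun u hu => ?_, by simp [h₁], by simp [h₂]⟩
      rcases List.mem_cons.1 hu with rfl | hu
      · exact hA
      · exact hL u hu
  obtain ⟨L, hL, h₁, h₂⟩ := key hl hT
  have hchain : (L.map Prod.snd).IsChain (Compatible G) := by
    rw [List.isChain_map]
    rw [← h₁, List.isChain_map] at hl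
    refine List.IsChain.imp_of_mem_imp ?_ hl
    intro u v hu hv huv
    exact hF u (hL u hu) v (hL v hv) huv
  have hlen : 2 ≤ (L.map Prod.snd).length := by
    have := hG g hg
    rw [← h₂] at this
    simpa using this
  refine map_fst_notMem_of_isChain_compatible hlen hchain ?_
  rw [List.map_map]
  rwa [← h₂] at hg

end States

open Classical in
/-- The Kleitman–Winston graph container lemma. -/
theorem exists_container {V : Type*} [DecidableEq V] (adj : V → V → Prop) (hirr : ∀ u, ¬ adj u u)
    {d : ℕ} (A : Finset V) :
    ∃ F : Finset V → Finset V,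
      (∀ S, F S ⊆ A ∧ ∀ u ∈ F S, ((F S).filter (adj u)).card < d) ∧
      ∀ I ⊆ A, (∀ u ∈ I, ∀ v ∈ I, ¬ adj u v) →
        ∃ S ⊆ I, S.card * d ≤ A.card ∧ I ⊆ S ∪ F S := by
  induction A using Finset.strongInduction with
  | H A ih =>
    by_cases hA : ∀ u ∈ A, (A.filter (adj u)).card < d
    · exact ⟨fun _ => A, fun _ => ⟨subset_rfl, hA⟩,
        fun I hI _ => ⟨∅, by simp, by simp, by simpa using hI⟩⟩
    push Not at hA
    obtain ⟨v, hv, hdv⟩ := hA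
    obtain ⟨F₀, hF₀, hI₀⟩ := ih (A.erase v) (Finset.erase_ssubset hv)
    obtain ⟨F₁, hF₁, hI₁⟩ := ih ((A.erase v) \ A.filter (adj v))
      (Finset.ssubset_of_subset_of_ssubset Finset.sdiff_subset (Finset.erase_ssubset hv))
    -- The fingerprint `S` records at each high-degree vertex which branch was taken, so the
    -- container depends on `S` alone.
    refine ⟨fun S => if v ∈ S then F₁ (S.erase v) else F₀ S, fun S => ?_, fun I hI hind => ?_⟩
    · by_cases hS : v ∈ S
      · simp only [hS, if_true]
        exact ⟨(hF₁ _).1.trans (Finset.sdiff_subset.trans (Finset.erase_subset _ _)), (hF₁ _).2⟩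
      · simp only [hS, if_false]
        exact ⟨(hF₀ _).1.trans (Finset.erase_subset _ _), (hF₀ _).2⟩
    · by_cases hvI : v ∈ I
      · obtain ⟨S, hSI, hS, hIS⟩ := hI₁ (I.erase v) (by
            intro u hu
            rw [Finset.mem_erase] at hu
            simp only [Finset.mem_sdiff, Finset.mem_erase, Finset.mem_filter, not_and]
            exact ⟨⟨hu.1, hI hu.2⟩, fun _ => hind v hvI u hu.2⟩)
          (fun u hu w hw => hind u (Finset.mem_of_mem_erase hu) w (Finset.mem_of_mem_erase hw))
        have hvS : v ∉ S := fun h => by simpa using hSI h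
        refine ⟨insert v S, ?_, ?_, ?_⟩
        · intro u hu
          rcases Finset.mem_insert.1 hu with rfl | hu
          · exact hvI
          · exact Finset.mem_of_mem_erase (hSI hu)
        -- Adding `v` to the fingerprint is paid for by the at least `d` out-neighbours removed from
        -- `A`.
        · rw [Finset.card_insert_of_notMem hvS, add_mul, one_mul]
          have hsub : A.filter (adj v) ⊆ A.erase v := by
            intro u hu
            rw [Finset.mem_filter] at hu
            refine Finset.mem_erase.2 ⟨?_, hu.1⟩
            rintro rfl
            exact hirr _ hu.2
          have h₁ := Finset.card_sdiff_add_card_eq_card hsub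
          have h₂ := Finset.card_erase_le (s := A) (a := v)
          omega
        · simp only [Finset.mem_insert_self, if_true, Finset.erase_insert hvS]
          intro u hu
          by_cases huv : u = v
          · simp [huv]
          · have := hIS (Finset.mem_erase.2 ⟨huv, hu⟩)
            simp only [Finset.mem_union, Finset.mem_insert] at this ⊢
            tauto
      · obtain ⟨S, hSI, hS, hIS⟩ := hI₀ I (fun u hu => Finset.mem_erase.2
          ⟨fun h => hvI (h ▸ hu), hI hu⟩) hind
        have hvS : v ∉ S := fun h => hvI (hSI h)
        refine ⟨S, hSI, hS.trans (Finset.card_le_card (Finset.erase_subset _ _)), ?_⟩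
        simpa only [hvS, if_false] using hIS

/-- The number of subsets of `A` with at most `t` elements. -/
theorem card_filter_card_le {V : Type*} (A : Finset V) (t : ℕ) {x : ℝ} (hx : 0 < x)
    (hx1 : x ≤ 1) :
    ((A.powerset.filter fun S => S.card ≤ t).card : ℝ) ≤
      Real.exp (x * A.card + t * Real.log x⁻¹) := by
  classical
  -- Give each subset `S` the weight `x ^ S.card`, which is at least `x ^ t` for the counted ones.
  have h₁ : ((A.powerset.filter fun S => S.card ≤ t).card : ℝ) * x ^ t ≤ (1 + x) ^ A.card := by
    rw [add_comm, ← Finset.sum_pow_mul_eq_add_pow, Finset.card_eq_sum_ones, Nat.cast_sum,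
      Finset.sum_mul]
    refine (Finset.sum_le_sum fun S hS => ?_).trans
      (Finset.sum_le_sum_of_subset_of_nonneg (Finset.filter_subset _ _)
        fun S _ _ => by positivity)
    simpa using pow_le_pow_of_le_one hx.le hx1 (Finset.mem_filter.1 hS).2
  have h₂ : (1 + x) ^ A.card ≤ Real.exp (x * A.card) := by
    rw [mul_comm, Real.exp_nat_mul]
    refine pow_le_pow_left₀ (by positivity) ?_ _
    linarith [Real.add_one_le_exp x]
  have h₃ : Real.exp (t * Real.log x⁻¹) * x ^ t = 1 := by
    rw [Real.exp_nat_mul, Real.exp_log (by positivity), ← mul_pow, inv_mul_cancel₀ hx.ne',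
      one_pow]
  rw [Real.exp_add]
  calc _ = ((A.powerset.filter fun S => S.card ≤ t).card : ℝ) * x ^ t *
        Real.exp (t * Real.log x⁻¹) := by
          rw [mul_assoc, mul_comm (x ^ t), h₃, mul_one]
    _ ≤ _ := by gcongr; exact h₁.trans h₂

/-! ### Maximal chains of the cube as numberings -/

section Numberings

open Numbering

variable {X : Type*} [Fintype X] [DecidableEq X]

open Nat in
theorem card_prefixed_inter_le {s t : Finset X} (hst : s ⊆ t) :
    (prefixed s ∩ prefixed t).card ≤
      s.card ! * (t.card - s.card)! * (Fintype.card X - t.card)! := by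
  let s' : Finset t := s.subtype (· ∈ t)
  have hs' : s'.card = s.card := by
    rw [Finset.card_subtype, Finset.filter_true_of_mem hst]
  have hmem (f : Numbering X) (hf : f ∈ prefixed s ∩ prefixed t) :
      ((prefixedEquiv t) ⟨f, (Finset.mem_inter.1 hf).2⟩).1 ∈ prefixed s' := by
    rw [mem_prefixed]
    intro z
    have := mem_prefixed.1 (Finset.mem_inter.1 hf).1 z
    rw [hs', Finset.mem_subtype, this]
    rfl
  have hcard : Fintype.card ↥(prefixed s ∩ prefixed t) ≤
      Fintype.card (↥(prefixed s') × Numbering ↥(tᶜ)) := by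
    refine Fintype.card_le_of_injective
      (fun f => (⟨((prefixedEquiv t) ⟨f, (Finset.mem_inter.1 f.2).2⟩).1, hmem f f.2⟩,
        ((prefixedEquiv t) ⟨f, (Finset.mem_inter.1 f.2).2⟩).2)) ?_
    intro f g hfg
    simp only [Prod.mk.injEq, Subtype.mk.injEq] at hfg
    have := (prefixedEquiv t).injective (Prod.ext hfg.1 hfg.2)
    exact Subtype.ext (Subtype.mk.inj this)
  rw [Fintype.card_coe, Fintype.card_prod, Fintype.card_coe, card_prefixed, hs',
    Fintype.card_numbering] at hcard
  simpa [Finset.card_compl] using hcard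

theorem self_le_choose {r k : ℕ} (h₁ : 1 ≤ k) (h₂ : k < r) : r ≤ r.choose k := by
  induction r generalizing k with
  | zero => omega
  | succ r ih =>
    obtain ⟨k, rfl⟩ := Nat.exists_eq_add_of_le' h₁
    rw [Nat.choose_succ_succ']
    rcases Nat.lt_or_ge (k + 1) r with h | h
    · have := ih (by omega) h
      have := Nat.choose_pos (show k ≤ r by omega)
      omega
    · obtain rfl : r = k + 1 := by omega
      simp

/-- Given `s` on the random chain, its member of size `t.card` is uniform among the supersets of `s`
of that size. Since `t` is neither `s` nor everything, there are at least `Fintype.card X - s.card`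
of these. -/
theorem mul_card_prefixed_inter_le {s t : Finset X} (hst : s ⊂ t) (ht : t ≠ Finset.univ) :
    (Fintype.card X - s.card) * (prefixed s ∩ prefixed t).card ≤ (prefixed s).card := by
  have h₁ := Finset.card_lt_card hst
  have h₂ : t.card < Fintype.card X := by
    rw [← Finset.card_univ]
    exact Finset.card_lt_card (Finset.ssubset_univ_iff.2 ht)
  have h₃ := self_le_choose (r := Fintype.card X - s.card) (k := t.card - s.card)
    (by omega) (by omega)
  have h₄ := Nat.choose_mul_factorial_mul_factorial
    (show t.card - s.card ≤ Fintype.card X - s.card by omega)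
  rw [show Fintype.card X - s.card - (t.card - s.card) = Fintype.card X - t.card by omega] at h₄
  calc _ ≤ (Fintype.card X - s.card).choose (t.card - s.card) *
        (s.card.factorial * (t.card - s.card).factorial *
          (Fintype.card X - t.card).factorial) :=
        Nat.mul_le_mul h₃ (card_prefixed_inter_le hst.1)
    _ = (prefixed s).card := by
        rw [card_prefixed, ← h₄]
        ring

theorem card_prefixed_mul_choose (s : Finset X) :
    (prefixed s).card * (Fintype.card X).choose s.card = (Fintype.card X).factorial := by
  rw [card_prefixed, ← Nat.choose_mul_factorial_mul_factorial s.card_le_univ]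
  ring

/-- The chain of the initial segments of a numbering. -/
def chainOf (f : Numbering X) : Finset (Finset X) := Finset.univ.filter fun s => IsPrefix f s

theorem mem_chainOf {f : Numbering X} {s : Finset X} : s ∈ chainOf f ↔ f ∈ prefixed s := by
  simp [chainOf]

theorem isChain_chainOf (f : Numbering X) :
    IsChain (· ≤ ·) (chainOf f : Set (Finset X)) := by
  intro s hs t ht _
  have hfs := mem_prefixed.1 (mem_chainOf.1 hs)
  have hft := mem_prefixed.1 (mem_chainOf.1 ht)
  rcases le_total s.card t.card with h | h
  · exact Or.inl (hfs.subset_of_card_le_card hft h)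
  · exact Or.inr (hft.subset_of_card_le_card hfs h)

/-- Double counting of the pairs of a numbering and an initial segment. -/
theorem factorial_mul_sum_le (w : Finset X → ℝ) (hw : ∀ s, 0 ≤ w s) :
    ((Fintype.card X).factorial : ℝ) * ∑ s, w s ≤
      (Fintype.card X).choose (Fintype.card X / 2) * ∑ f : Numbering X, ∑ s ∈ chainOf f, w s := by
  have h₁ : ∑ f : Numbering X, ∑ s ∈ chainOf f, w s = ∑ s, ((prefixed s).card : ℝ) * w s := by
    have : ∀ f : Numbering X, ∑ s ∈ chainOf f, w s =
        ∑ s, if f ∈ prefixed s then w s else 0 := fun f => by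
      rw [← Finset.sum_filter]
      refine Finset.sum_congr ?_ fun _ _ => rfl
      ext s
      simp [mem_chainOf]
    simp_rw [this]
    rw [Finset.sum_comm]
    refine Finset.sum_congr rfl fun s _ => ?_
    rw [← Finset.sum_filter, Finset.sum_const, nsmul_eq_mul]
    congr 3
    ext f
    simp
  rw [h₁, Finset.mul_sum, Finset.mul_sum]
  refine Finset.sum_le_sum fun s _ => ?_
  rw [← mul_assoc]
  refine mul_le_mul_of_nonneg_right ?_ (hw s)
  -- The LYM step: the probability that `s` is on the chain is the inverse of a binomial
  -- coefficient, which is at most the middle one.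
  rw [← card_prefixed_mul_choose s, mul_comm]
  exact_mod_cast Nat.mul_le_mul_right _ (Nat.choose_le_middle _ _)

end Numberings

/-! ### Weights along a chain and deletion of conflicts -/

section Weights

variable {P : Type*} {m : ℕ} {G : Finset (List (Fin m))} {p : Fin m → ℝ}

theorem sum_nonneg_of_nonneg (hp : ∀ i, 0 ≤ p i) (A : Finset (Fin m)) : 0 ≤ ∑ i ∈ A, p i :=
  Finset.sum_nonneg fun i _ => hp i

theorem log_one_add_sum_nonneg (hp : ∀ i, 0 ≤ p i) (A : Finset (Fin m)) :
    0 ≤ Real.log (1 + ∑ i ∈ A, p i) :=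
  Real.log_nonneg (by linarith [sum_nonneg_of_nonneg hp A])

/-- From 1 + a + b ≤ (1 + a)(1 + b) and log (1 + b) ≤ b: each discarded color costs at most 1. -/
theorem log_one_add_sum_le (hp : ∀ i, 0 ≤ p i) (hp1 : ∀ i, p i ≤ 1) {A B R : Finset (Fin m)}
    (h : A ⊆ B ∪ R) :
    Real.log (1 + ∑ i ∈ A, p i) ≤ Real.log (1 + ∑ i ∈ B, p i) + R.card := by
  have hB := sum_nonneg_of_nonneg hp B
  have hR := sum_nonneg_of_nonneg hp R
  have hA := sum_nonneg_of_nonneg hp A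
  have h₁ : ∑ i ∈ A, p i ≤ ∑ i ∈ B, p i + ∑ i ∈ R, p i := by
    refine (Finset.sum_le_sum_of_subset_of_nonneg h fun i _ _ => hp i).trans ?_
    rw [← Finset.sum_union_inter]
    linarith [sum_nonneg_of_nonneg hp (B ∩ R)]
  have h₂ : ∑ i ∈ R, p i ≤ R.card := by
    simpa using Finset.sum_le_sum fun i (_ : i ∈ R) => hp1 i
  calc Real.log (1 + ∑ i ∈ A, p i)
      ≤ Real.log ((1 + ∑ i ∈ B, p i) * (1 + ∑ i ∈ R, p i)) := by
        refine Real.log_le_log (by positivity) ?_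
        nlinarith [mul_nonneg hB hR]
    _ = Real.log (1 + ∑ i ∈ B, p i) + Real.log (1 + ∑ i ∈ R, p i) :=
        Real.log_mul (by positivity) (by positivity)
    _ ≤ _ := by
        have := Real.log_le_sub_one_of_pos (show 0 < 1 + ∑ i ∈ R, p i by positivity)
        linarith

theorem card_colorsOf_le [DecidableEq P] (R : Finset (P × State m)) (x : P) :
    (colorsOf R x).card ≤ (R.filter fun u => u.1 = x).card := by
  classical
  refine (Finset.card_le_card ?_).trans
    (Finset.card_image_le (s := R.filter fun u => u.1 = x) (f := fun u => u.2.1))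
  intro i hi
  obtain ⟨A, hA⟩ := mem_colorsOf.1 hi
  exact Finset.mem_image.2 ⟨(x, i, A), by simp [hA], rfl⟩

theorem sum_card_colorsOf_le (R : Finset (P × State m)) (C : Finset P) :
    ∑ x ∈ C, (colorsOf R x).card ≤ R.card := by
  classical
  refine (Finset.sum_le_sum fun x _ => card_colorsOf_le R x).trans ?_
  exact (Finset.sum_card_fiberwise_eq_card_filter R C Prod.fst).trans_le
    (Finset.card_filter_le _ _)

theorem colorsOf_subset_union {A B R : Finset (P × State m)} {x : P}
    (h : ∀ u ∈ A, u.1 = x → u ∈ B ∨ u ∈ R) : colorsOf A x ⊆ colorsOf B x ∪ colorsOf R x := by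
  intro i hi
  obtain ⟨S, hS⟩ := mem_colorsOf.1 hi
  rw [Finset.mem_union, mem_colorsOf, mem_colorsOf]
  exact (h _ hS rfl).imp (fun h => ⟨S, h⟩) fun h => ⟨S, h⟩

theorem sum_log_colorsOf_le (hp : ∀ i, 0 ≤ p i) (hp1 : ∀ i, p i ≤ 1)
    {A B R : Finset (P × State m)} {C : Finset P}
    (h : ∀ u ∈ A, u.1 ∈ C → u ∈ B ∨ u ∈ R) :
    ∑ x ∈ C, Real.log (1 + ∑ i ∈ colorsOf A x, p i) ≤
      ∑ x ∈ C, Real.log (1 + ∑ i ∈ colorsOf B x, p i) + R.card := by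
  calc _ ≤ ∑ x ∈ C, (Real.log (1 + ∑ i ∈ colorsOf B x, p i) + (colorsOf R x).card) :=
        Finset.sum_le_sum fun x hx => log_one_add_sum_le hp hp1
          (colorsOf_subset_union fun u hu hux => h u hu (hux ▸ hx))
    _ ≤ _ := by
        rw [Finset.sum_add_distrib]
        have : (∑ x ∈ C, ((colorsOf R x).card : ℝ)) ≤ R.card := by
          exact_mod_cast sum_card_colorsOf_le R C
        linarith

/-- Two points with states that cannot both occur in the labelling of a valid colored subset. -/
def Conflict [Preorder P] (G : Finset (List (Fin m))) (u v : P × State m) : Prop :=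
  u.1 < v.1 ∧ ¬ Compatible G u.2 v.2

open Classical in
/-- The number of conflicts in a set of points with states. -/
noncomputable def numConflicts [Preorder P] (G : Finset (List (Fin m)))
    (F : Finset (P × State m)) : ℕ :=
  ∑ u ∈ F, (F.filter (Conflict G u)).card

/-- Delete every lower endpoint of a conflict; each deleted element accounts for at least one
conflict of its own. -/
theorem exists_conflictFree [Preorder P] (F : Finset (P × State m)) :
    ∃ F' R : Finset (P × State m), F' ⊆ F ∧ (∀ u ∈ F, u ∈ F' ∨ u ∈ R) ∧
      F.card ≤ F'.card + R.card ∧ R.card ≤ numConflicts G F ∧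
      ∀ u ∈ F', ∀ v ∈ F', u.1 < v.1 → Compatible G u.2 v.2 := by
  classical
  refine ⟨F.filter fun u => ¬ ∃ v ∈ F, Conflict G u v, F.filter fun u => ∃ v ∈ F, Conflict G u v,
    Finset.filter_subset _ _, ?_, ?_, ?_, ?_⟩
  · intro u hu
    simp only [Finset.mem_filter, hu, true_and]
    tauto
  · rw [add_comm, Finset.card_filter_add_card_filter_not]
  · rw [numConflicts, Finset.card_eq_sum_ones, Finset.sum_filter]
    refine Finset.sum_le_sum fun u _ => ?_
    split_ifs with h
    · obtain ⟨v, hv, hc⟩ := h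
      exact Finset.card_pos.2 ⟨v, Finset.mem_filter.2 ⟨hv, hc⟩⟩
    · exact Nat.zero_le _
  · intro u hu v hv huv
    by_contra hc
    exact (Finset.mem_filter.1 hu).2 ⟨v, (Finset.mem_filter.1 hv).1, huv, hc⟩

/-- The underlying points lie in the support of a valid template on a chain, and each carries at
most `Q.card` states. -/
theorem card_le_of_conflictFree [PartialOrder P] (hG : ∀ g ∈ G, 2 ≤ g.length) (h : IsSparse G)
    {F : Finset (P × State m)} {C : Finset P} (hC : IsChain (· ≤ ·) (C : Set P))
    {Q : Finset (State m)} (hF : F ⊆ C ×ˢ Q)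
    (hF' : ∀ u ∈ F, ∀ v ∈ F, u.1 < v.1 → Compatible G u.2 v.2) :
    F.card ≤ Q.card * chainBound h := by
  classical
  have h₁ : (F.image Prod.fst).card ≤ chainBound h := by
    refine card_le_chainBound h (isValid_colorsOf hG hF') _ (hC.mono ?_) ?_
    · intro x hx
      obtain ⟨u, hu, rfl⟩ := Finset.mem_image.1 hx
      exact (Finset.mem_product.1 (hF hu)).1
    · intro x hx
      obtain ⟨u, hu, rfl⟩ := Finset.mem_image.1 hx
      exact Finset.ne_empty_of_mem (mem_colorsOf.2 ⟨u.2.2, hu⟩)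
  have h₂ : F ⊆ F.image Prod.fst ×ˢ Q := fun u hu =>
    Finset.mem_product.2 ⟨Finset.mem_image_of_mem _ hu, (Finset.mem_product.1 (hF hu)).2⟩
  calc _ ≤ _ := Finset.card_le_card h₂
    _ = Q.card * (F.image Prod.fst).card := by rw [Finset.card_product, mul_comm]
    _ ≤ _ := Nat.mul_le_mul_left _ h₁

theorem card_le_add_numConflicts [PartialOrder P] (hG : ∀ g ∈ G, 2 ≤ g.length) (h : IsSparse G)
    {F : Finset (P × State m)} {C : Finset P} (hC : IsChain (· ≤ ·) (C : Set P))
    {Q : Finset (State m)} (hF : F ⊆ C ×ˢ Q) :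
    F.card ≤ Q.card * chainBound h + numConflicts G F := by
  obtain ⟨F', R, h₁, -, h₃, h₄, h₅⟩ := exists_conflictFree (G := G) F
  have := card_le_of_conflictFree hG h hC (h₁.trans hF) h₅
  omega

theorem sum_log_colorsOf_le_omegaCrit [PartialOrder P] (hG : ∀ g ∈ G, 2 ≤ g.length)
    (h : IsSparse G) (hp : ∀ i, 0 ≤ p i) (hp1 : ∀ i, p i ≤ 1)
    (F : Finset (P × State m)) {C : Finset P} [DecidablePred fun u : P × State m => u.1 ∈ C]
    (hC : IsChain (· ≤ ·) (C : Set P)) :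
    ∑ x ∈ C, Real.log (1 + ∑ i ∈ colorsOf F x, p i) ≤
      omegaCrit G p + numConflicts G (F.filter fun u => u.1 ∈ C) := by
  obtain ⟨F', R, -, h₂, -, h₄, h₅⟩ :=
    exists_conflictFree (G := G) (F.filter fun u => u.1 ∈ C)
  have h₆ := (isGreatest_omegaCrit hG h p).2
    (sum_log_mem_chainWeights p (isValid_colorsOf hG h₅) C hC)
  have h₇ := sum_log_colorsOf_le hp hp1 (A := F) (B := F') (R := R) (C := C)
    fun u hu hx => h₂ u (Finset.mem_filter.2 ⟨hu, hx⟩)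
  have h₈ : (R.card : ℝ) ≤ numConflicts G (F.filter fun u => u.1 ∈ C) := by exact_mod_cast h₄
  linarith

end Weights

/-! ### Averaging over maximal chains -/

section Cube

open Numbering

variable {n m : ℕ} {G : Finset (List (Fin m))} {p : Fin m → ℝ}

/-- The sets of size at most `3 n / 4`. -/
def lowerSets (n : ℕ) : Finset (Finset (Fin n)) := Finset.univ.filter fun s => 4 * s.card ≤ 3 * n

theorem card_univ_numbering_fin :
    (Finset.univ : Finset (Numbering (Fin n))).card = n.factorial := by
  rw [Finset.card_univ, Fintype.card_numbering]
  simp only [Fintype.card_fin]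

-- An element `u` has fewer than `d` conflicts, all with sets above it. Given `u` on the chain, each
-- of them occurs with probability at most 1/(n - |u|) ≤ 4/n; this is why only sets of size at most
-- 3n/4 are used.
open Classical in
theorem sum_numConflicts_le (hn : 0 < n) {Q : Finset (State m)}
    {F : Finset (Finset (Fin n) × State m)} (hF : F ⊆ lowerSets n ×ˢ Q) {d : ℕ}
    (hd : ∀ u ∈ F, (F.filter (Conflict G u)).card < d) :
    n * ∑ f : Numbering (Fin n), numConflicts G (F.filter fun u => u.1 ∈ chainOf f) ≤
      4 * d * ∑ f : Numbering (Fin n), (F.filter fun u => u.1 ∈ chainOf f).card := by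
  have hcount (s : Finset (Fin n)) :
      ∑ f : Numbering (Fin n), (if s ∈ chainOf f then 1 else 0) = (prefixed s).card := by
    rw [← Finset.card_filter]
    congr 1
    ext f
    simp [mem_chainOf]
  have h₁ : ∑ f : Numbering (Fin n), (F.filter fun u => u.1 ∈ chainOf f).card =
      ∑ u ∈ F, (prefixed u.1).card := by
    simp_rw [Finset.card_filter]
    rw [Finset.sum_comm]
    exact Finset.sum_congr rfl fun u _ => hcount u.1
  have h₂ : ∑ f : Numbering (Fin n), numConflicts G (F.filter fun u => u.1 ∈ chainOf f) =
      ∑ u ∈ F, ∑ v ∈ F.filter (Conflict G u), (prefixed u.1 ∩ prefixed v.1).card := by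
    have (f : Numbering (Fin n)) : numConflicts G (F.filter fun u => u.1 ∈ chainOf f) =
        ∑ u ∈ F, ∑ v ∈ F.filter (Conflict G u),
          if f ∈ prefixed u.1 ∩ prefixed v.1 then 1 else 0 := by
      rw [numConflicts, Finset.sum_filter]
      refine Finset.sum_congr rfl fun u _ => ?_
      simp only [mem_chainOf, Finset.mem_inter]
      split_ifs with h
      · simp only [h, true_and]
        rw [← Finset.card_filter, Finset.filter_comm]
      · simp [h]
    simp_rw [this]
    rw [Finset.sum_comm]
    refine Finset.sum_congr rfl fun u _ => ?_
    rw [Finset.sum_comm]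
    refine Finset.sum_congr rfl fun v _ => ?_
    rw [← Finset.card_filter]
    congr 1
    ext f
    simp
  rw [h₁, h₂, Finset.mul_sum, Finset.mul_sum]
  refine Finset.sum_le_sum fun u hu => ?_
  have hu' : 4 * u.1.card ≤ 3 * n := by
    simpa [lowerSets] using (Finset.mem_product.1 (hF hu)).1
  have hpair : ∀ v ∈ F.filter (Conflict G u),
      n * (prefixed u.1 ∩ prefixed v.1).card ≤ 4 * (prefixed u.1).card := by
    intro v hv
    rw [Finset.mem_filter] at hv
    -- The full set lies on every maximal chain and has to be excluded as upper endpoint.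
    have hv' : 4 * v.1.card ≤ 3 * n := by
      simpa [lowerSets] using (Finset.mem_product.1 (hF hv.1)).1
    have hne : v.1 ≠ Finset.univ := by
      intro h
      rw [h, Finset.card_univ, Fintype.card_fin] at hv'
      omega
    have := mul_card_prefixed_inter_le hv.2.1 hne
    simp only [Fintype.card_fin] at this
    calc _ ≤ (4 * (n - u.1.card)) * (prefixed u.1 ∩ prefixed v.1).card :=
          Nat.mul_le_mul_right _ (by omega)
      _ = 4 * ((n - u.1.card) * (prefixed u.1 ∩ prefixed v.1).card) := by ring
      _ ≤ _ := Nat.mul_le_mul_left _ this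
  rw [Finset.mul_sum]
  refine (Finset.sum_le_sum hpair).trans ?_
  rw [Finset.sum_const, smul_eq_mul]
  calc _ ≤ d * (4 * (prefixed u.1).card) := Nat.mul_le_mul_right _ (hd u hu).le
    _ = _ := by ring

open Classical in
/-- A set of points with states in which no point has many conflicts gives a template of weight
not much larger than that of a valid one. -/
theorem weight_colorsOf_le (hG : ∀ g ∈ G, 2 ≤ g.length) (h : IsSparse G) (hp : ∀ i, 0 ≤ p i)
    (hp1 : ∀ i, p i ≤ 1) {Q : Finset (State m)}
    {F : Finset (Finset (Fin n) × State m)} (hF : F ⊆ lowerSets n ×ˢ Q) {d : ℕ}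
    (hd : ∀ u ∈ F, (F.filter (Conflict G u)).card < d) (hn : 0 < n) (hdn : 8 * d ≤ n) :
    (colorsOf F).weight p ≤
      n.choose (n / 2) * (omegaCrit G p + 8 * d / n * (Q.card * chainBound h : ℕ)) := by
  set K := Q.card * chainBound h
  set X : Numbering (Fin n) → ℕ := fun f => numConflicts G (F.filter fun u => u.1 ∈ chainOf f)
  have h₁ : ∑ f, (F.filter fun u => u.1 ∈ chainOf f).card ≤ n.factorial * K + ∑ f, X f := by
    calc _ ≤ ∑ f : Numbering (Fin n), (K + X f) := by
          refine Finset.sum_le_sum fun f _ => ?_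
          refine card_le_add_numConflicts hG h (isChain_chainOf f) (Q := Q) fun u hu => ?_
          rw [Finset.mem_filter] at hu
          exact Finset.mem_product.2 ⟨hu.2, (Finset.mem_product.1 (hF hu.1)).2⟩
      _ = _ := by
          rw [Finset.sum_add_distrib, Finset.sum_const, card_univ_numbering_fin, smul_eq_mul]
  have h₂ := sum_numConflicts_le hn hF hd
  -- The conflicts bound the size and the size bounds the conflicts; `8 * d ≤ n` lets half of the
  -- left side absorb the conflict term on the right.
  have h₃ : n * ∑ f, X f ≤ 8 * d * (n.factorial * K) := by
    have h₄ : n * ∑ f, X f ≤ 4 * d * (n.factorial * K + ∑ f, X f) :=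
      h₂.trans (Nat.mul_le_mul_left _ h₁)
    have h₅ : 8 * d * ∑ f, X f ≤ n * ∑ f, X f := Nat.mul_le_mul_right _ hdn
    nlinarith
  have h₄ : (∑ f, (X f : ℝ)) ≤ n.factorial * (8 * d / n * K) := by
    have h₃' : (n : ℝ) * ∑ f, (X f : ℝ) ≤ 8 * d * (n.factorial * K) := by exact_mod_cast h₃
    have hn' : (0 : ℝ) < n := by exact_mod_cast hn
    rw [show (n.factorial : ℝ) * (8 * d / n * K) = 8 * d * (n.factorial * K) / n by ring,
      le_div_iff₀ hn']
    linarith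
  have h₅ := factorial_mul_sum_le (fun x => Real.log (1 + ∑ i ∈ colorsOf F x, p i))
    fun x => log_one_add_sum_nonneg hp _
  simp only [Fintype.card_fin] at h₅
  have h₆ : ∑ f : Numbering (Fin n), ∑ x ∈ chainOf f, Real.log (1 + ∑ i ∈ colorsOf F x, p i) ≤
      n.factorial * (omegaCrit G p + 8 * d / n * K) := by
    calc _ ≤ ∑ f : Numbering (Fin n), (omegaCrit G p + X f) :=
          Finset.sum_le_sum fun f _ =>
            sum_log_colorsOf_le_omegaCrit hG h hp hp1 F (isChain_chainOf f)
      _ = n.factorial * omegaCrit G p + ∑ f, (X f : ℝ) := by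
          rw [Finset.sum_add_distrib, Finset.sum_const, card_univ_numbering_fin, nsmul_eq_mul]
      _ ≤ _ := by rw [mul_add]; linarith
  have hfac : (0 : ℝ) < n.factorial := by exact_mod_cast n.factorial_pos
  have h₇ := h₅.trans (mul_le_mul_of_nonneg_left h₆ (Nat.cast_nonneg (n.choose (n / 2))))
  rw [mul_left_comm] at h₇
  exact le_of_mul_le_mul_left h₇ hfac

end Cube

/-! ### The partition sum and templates -/

section Partition

variable {m : ℕ} {G : Finset (List (Fin m))} {p : Fin m → ℝ}

open Classical in
/-- The sum of the weights `∏ p (c x)` over all valid colored subsets `c` of `P`. -/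
noncomputable def partitionSum (G : Finset (List (Fin m))) (p : Fin m → ℝ) (P : Type*)
    [Fintype P] [Preorder P] : ℝ :=
  ∑ c : ColoredSubset P m with IsValid G c, ∏ x, (c x).elim 1 p

theorem elim_nonneg (hp : ∀ i, 0 ≤ p i) (o : Option (Fin m)) : 0 ≤ o.elim 1 p := by
  cases o <;> simp [hp]

-- The sum factors over the points; at `x` the uncolored option gives 1 and the allowed colors give
-- their `p i`.
open Classical in
theorem sum_prod_elim_eq_exp_weight {P : Type*} [Fintype P] (hp : ∀ i, 0 ≤ p i)
    (T : Template P m) :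
    ∑ c : ColoredSubset P m with ∀ x i, c x = some i → i ∈ T x, ∏ x, (c x).elim 1 p =
      Real.exp (T.weight p) := by
  have h₁ (x : P) : Real.exp (Real.log (1 + ∑ i ∈ T x, p i)) =
      ∑ o ∈ Finset.insertNone (T x), o.elim 1 p := by
    rw [Real.exp_log (by linarith [sum_nonneg_of_nonneg hp (T x)]), Finset.sum_insertNone]
    simp
  rw [Template.weight, Real.exp_sum, Finset.prod_congr rfl fun x _ => h₁ x,
    Finset.prod_univ_sum]
  refine Finset.sum_congr ?_ fun _ _ => rfl
  ext c
  simp [Finset.mem_insertNone, Option.mem_def]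

theorem exp_weight_le_partitionSum {P : Type*} [Fintype P] [Preorder P] (hp : ∀ i, 0 ≤ p i)
    {T : Template P m} (hT : T.IsValid G) : Real.exp (T.weight p) ≤ partitionSum G p P := by
  classical
  rw [← sum_prod_elim_eq_exp_weight hp, partitionSum]
  refine Finset.sum_le_sum_of_subset_of_nonneg ?_
    fun c _ _ => Finset.prod_nonneg fun x _ => elim_nonneg hp _
  intro c hc
  simp only [Finset.mem_filter, Finset.mem_univ, true_and] at hc ⊢
  exact hT.isValid_of_forall_mem hc

theorem one_le_partitionSum {P : Type*} [Fintype P] [Preorder P] (hG : ∀ g ∈ G, 2 ≤ g.length)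
    (hp : ∀ i, 0 ≤ p i) : 1 ≤ partitionSum G p P := by
  have hT : Template.IsValid G (fun _ : P => (∅ : Finset (Fin m))) := by
    rw [Template.isValid_iff]
    rintro g hg ⟨x, -, hx⟩
    simpa using hx ⟨0, by have := hG g hg; omega⟩
  simpa [Template.weight] using exp_weight_le_partitionSum hp hT

/-- A union bound. The covering templates need not be valid, so containers qualify. -/
theorem partitionSum_le_sum {P : Type*} [Fintype P] [Preorder P] (hp : ∀ i, 0 ≤ p i)
    {ι : Type*} (s : Finset ι) (T : ι → Template P m)
    (h : ∀ c : ColoredSubset P m, IsValid G c → ∃ j ∈ s, ∀ x i, c x = some i → i ∈ T j x) :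
    partitionSum G p P ≤ ∑ j ∈ s, Real.exp ((T j).weight p) := by
  classical
  simp_rw [← sum_prod_elim_eq_exp_weight hp]
  rw [partitionSum]
  have hnn (c : ColoredSubset P m) : 0 ≤ ∏ x, (c x).elim 1 p :=
    Finset.prod_nonneg fun x _ => elim_nonneg hp _
  rw [Finset.sum_filter]
  simp_rw [Finset.sum_filter]
  rw [Finset.sum_comm]
  refine Finset.sum_le_sum fun c _ => ?_
  have hite (j : ι) :
      0 ≤ if ∀ x i, c x = some i → i ∈ T j x then ∏ x, (c x).elim 1 p else 0 := by
    split_ifs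
    exacts [hnn c, le_rfl]
  split_ifs with hc
  · obtain ⟨j, hj, hcj⟩ := h c hc
    refine le_trans ?_ (Finset.single_le_sum (fun j _ => hite j) hj)
    rw [if_pos hcj]
  · exact Finset.sum_nonneg fun j _ => hite j

end Partition

/-! ### Upper bound by containers -/

section UpperBound

variable {n m : ℕ} {G : Finset (List (Fin m))} {p : Fin m → ℝ}

/-- The states that use only suffixes of words in `G`. -/
noncomputable def states (G : Finset (List (Fin m))) : Finset (State m) :=
  Finset.univ ×ˢ (suffixes G).powerset

open Classical in
/-- The template of the colors of `F` on `M` which allows all colors outside `M`. -/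
noncomputable def extendTemplate {P : Type*} (M : Finset P) (F : Finset (P × State m)) :
    Template P m :=
  fun x => if x ∈ M then colorsOf F x else Finset.univ

theorem weight_extendTemplate_le {P : Type*} [Fintype P] [DecidableEq P] (hp : ∀ i, 0 ≤ p i)
    (hp1 : ∑ i, p i ≤ 1) (M : Finset P) (S F : Finset (P × State m)) :
    (extendTemplate M (S ∪ F)).weight p ≤ (colorsOf F).weight p + S.card + Mᶜ.card := by
  have hp1' (i) : p i ≤ 1 :=
    (Finset.single_le_sum (fun j _ => hp j) (Finset.mem_univ i)).trans hp1
  rw [Template.weight, Template.weight, ← Finset.sum_add_sum_compl M]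
  have h₁ : ∑ x ∈ M, Real.log (1 + ∑ i ∈ extendTemplate M (S ∪ F) x, p i) ≤
      ∑ x ∈ M, Real.log (1 + ∑ i ∈ colorsOf F x, p i) + S.card := by
    refine le_trans (Finset.sum_congr rfl fun x hx => ?_).le
      (sum_log_colorsOf_le hp hp1' (A := S ∪ F) (B := F) (R := S) (C := M) ?_)
    · rw [extendTemplate, if_pos hx]
    · intro u hu _
      exact (Finset.mem_union.1 hu).symm
  have h₂ : ∑ x ∈ M, Real.log (1 + ∑ i ∈ colorsOf F x, p i) ≤
      ∑ x, Real.log (1 + ∑ i ∈ colorsOf F x, p i) :=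
    Finset.sum_le_sum_of_subset_of_nonneg (Finset.subset_univ _)
      fun x _ _ => log_one_add_sum_nonneg hp _
  have h₃ : ∑ x ∈ Mᶜ, Real.log (1 + ∑ i ∈ extendTemplate M (S ∪ F) x, p i) ≤ Mᶜ.card := by
    rw [Finset.card_eq_sum_ones, Nat.cast_sum]
    refine Finset.sum_le_sum fun x _ => ?_
    have h₀ := sum_nonneg_of_nonneg hp (extendTemplate M (S ∪ F) x)
    have h₄ : ∑ i ∈ extendTemplate M (S ∪ F) x, p i ≤ 1 :=
      (Finset.sum_le_sum_of_subset_of_nonneg (Finset.subset_univ _) fun i _ _ => hp i).trans hp1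
    have := Real.log_le_sub_one_of_pos (show 0 < 1 + ∑ i ∈ extendTemplate M (S ∪ F) x, p i by
      linarith)
    push_cast
    linarith
  linarith

theorem mem_extendTemplate_of_container {P : Type*} [Preorder P] [DecidableEq P] {M : Finset P}
    {c : ColoredSubset P m} {S F : Finset (P × State m)}
    (h : ∀ u ∈ M ×ˢ states G, c u.1 = some u.2.1 → u.2.2 = wordsAbove G c u.1 → u ∈ S ∪ F)
    (x : P) (i : Fin m) (hx : c x = some i) : i ∈ extendTemplate M (S ∪ F) x := by
  rw [extendTemplate]
  split_ifs with hM
  · refine mem_colorsOf.2 ⟨wordsAbove G c x, h _ ?_ hx rfl⟩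
    simp only [Finset.mem_product, states, Finset.mem_univ, true_and, Finset.mem_powerset, hM]
    exact wordsAbove_subset c x
  · exact Finset.mem_univ _

/-- Sum over the fingerprints. In the factor 2 + log d, one unit is the weight of the fingerprint
itself; the rest comes from counting fingerprints. The sets above 3n/4 are left unrestricted and
cost at most 1 each. -/
theorem partitionSum_le (hG : ∀ g ∈ G, 2 ≤ g.length) (h : IsSparse G) (hp : ∀ i, 0 ≤ p i)
    (hp1 : ∑ i, p i ≤ 1) {d : ℕ} (hd : 0 < d) (hdn : 8 * d ≤ n) :
    Real.log (partitionSum G p (Finset (Fin n))) ≤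
      n.choose (n / 2) * (omegaCrit G p +
        8 * d / n * ((states G).card * chainBound h : ℕ)) +
      (2 + Real.log d) * ((states G).card * 2 ^ n / d) + (lowerSets n)ᶜ.card := by
  classical
  have hp1' (i) : p i ≤ 1 :=
    (Finset.single_le_sum (fun j _ => hp j) (Finset.mem_univ i)).trans hp1
  set A := lowerSets n ×ˢ states G with hA
  obtain ⟨F, hF, hI⟩ := exists_container (d := d) (Conflict G)
    (fun u hu => lt_irrefl _ hu.1) A
  set t := A.card / d
  have hcover := partitionSum_le_sum (G := G) hp (A.powerset.filter fun S => S.card ≤ t)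
    (fun S => extendTemplate (lowerSets n) (S ∪ F S)) (by
      intro c hc
      obtain ⟨S, hSI, hS, hIS⟩ := hI
        (A.filter fun u => c u.1 = some u.2.1 ∧ u.2.2 = wordsAbove G c u.1)
        (Finset.filter_subset _ _) (by
          intro u hu v hv huv
          obtain ⟨-, hu₁, hu₂⟩ := Finset.mem_filter.1 hu
          obtain ⟨-, hv₁, hv₂⟩ := Finset.mem_filter.1 hv
          refine huv.2 ?_
          have := compatible_wordsAbove hc huv.1 hu₁ hv₁
          rwa [← hu₂, ← hv₂] at this)
      refine ⟨S, ?_, mem_extendTemplate_of_container fun u hu h₁ h₂ =>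
        hIS (Finset.mem_filter.2 ⟨hu, h₁, h₂⟩)⟩
      rw [Finset.mem_filter, Finset.mem_powerset]
      exact ⟨hSI.trans (Finset.filter_subset _ _), (Nat.le_div_iff_mul_le hd).2 hS⟩)
  set W : ℝ := n.choose (n / 2) * (omegaCrit G p +
        8 * d / n * ((states G).card * chainBound h : ℕ))
  have hweight : ∀ S ∈ A.powerset.filter fun S => S.card ≤ t,
      (extendTemplate (lowerSets n) (S ∪ F S)).weight p ≤ W + t + (lowerSets n)ᶜ.card := by
    intro S hS
    have h₁ := weight_extendTemplate_le hp hp1 (lowerSets n) S (F S)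
    have h₂ := weight_colorsOf_le hG h hp hp1' (hF S).1 (hF S).2 (by omega) hdn
    have h₃ : (S.card : ℝ) ≤ t := by exact_mod_cast (Finset.mem_filter.1 hS).2
    refine h₁.trans ?_
    linarith
  have hd' : (1 : ℝ) ≤ d := by exact_mod_cast hd
  -- The choice x = 1/d balances `x * A.card` against the maximal fingerprint size `A.card / d`.
  have hcard := card_filter_card_le A t (x := (d : ℝ)⁻¹) (by positivity) (inv_le_one_of_one_le₀ hd')
  rw [inv_inv] at hcard
  have hZ : partitionSum G p (Finset (Fin n)) ≤
      Real.exp ((d : ℝ)⁻¹ * A.card + t * Real.log d + (W + t + (lowerSets n)ᶜ.card)) := by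
    refine hcover.trans ((Finset.sum_le_card_nsmul _ _ _ fun S hS =>
      Real.exp_le_exp.2 (hweight S hS)).trans ?_)
    rw [nsmul_eq_mul, Real.exp_add ((d : ℝ)⁻¹ * A.card + t * Real.log d)]
    exact mul_le_mul_of_nonneg_right hcard (Real.exp_pos _).le
  have hZpos : 0 < partitionSum G p (Finset (Fin n)) :=
    zero_lt_one.trans_le (one_le_partitionSum hG hp)
  have hlog := (Real.log_le_iff_le_exp hZpos).2 hZ
  have hAcard : (A.card : ℝ) ≤ (states G).card * 2 ^ n := by
    have h₁ : (lowerSets n).card ≤ 2 ^ n := by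
      refine (Finset.card_le_univ _).trans ?_
      simp
    rw [hA, Finset.card_product, mul_comm]
    push_cast
    gcongr
    exact_mod_cast h₁
  have hB : (d : ℝ)⁻¹ * A.card ≤ (states G).card * 2 ^ n / d := by
    rw [inv_mul_eq_div]
    gcongr
  have ht' : (t : ℝ) ≤ (states G).card * 2 ^ n / d := by
    refine le_trans ?_ hB
    rw [inv_mul_eq_div]
    exact Nat.cast_div_le
  have hlogd := Real.log_nonneg hd'
  have := mul_le_mul_of_nonneg_right ht' hlogd
  nlinarith

end UpperBound

/-! ### Lower bound from consecutive layers -/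

section LowerBound

variable {n m : ℕ} {G : Finset (List (Fin m))} {p : Fin m → ℝ}

open Classical in
/-- The template on `Finset (Fin n)` which uses `T j` on the layer of sets of size `k + j`. -/
noncomputable def layerTemplate (n k : ℕ) {l : ℕ} (T : Template (Fin l) m) :
    Template (Finset (Fin n)) m :=
  fun s => Finset.univ.filter fun i => ∃ j : Fin l, s.card = k + j ∧ i ∈ T j

/-- Cardinality is strictly increasing, so a forbidden chain in the cube would project to one in
`Fin l`. -/
theorem isValid_layerTemplate (k : ℕ) {l : ℕ} {T : Template (Fin l) m} (hT : T.IsValid G) :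
    (layerTemplate n k T).IsValid G := by
  rw [Template.isValid_iff] at hT ⊢
  rintro g hg ⟨x, hx, hxT⟩
  simp only [layerTemplate, Finset.mem_filter, Finset.mem_univ, true_and] at hxT
  choose j hj hjT using hxT
  refine hT g hg ⟨j, fun a b hab => ?_, hjT⟩
  have h₁ := Finset.card_lt_card (hx hab)
  rw [hj a, hj b] at h₁
  exact Fin.lt_def.2 (by omega)

theorem weight_layerTemplate (k : ℕ) {l : ℕ} (T : Template (Fin l) m) :
    (layerTemplate n k T).weight p =
      ∑ j : Fin l, (n.choose (k + j) : ℝ) * Real.log (1 + ∑ i ∈ T j, p i) := by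
  classical
  have h₁ (s : Finset (Fin n)) : Real.log (1 + ∑ i ∈ layerTemplate n k T s, p i) =
      ∑ j : Fin l, if s.card = k + j then Real.log (1 + ∑ i ∈ T j, p i) else 0 := by
    by_cases h : ∃ j : Fin l, s.card = k + j
    · obtain ⟨j, hj⟩ := h
      have huniq (j' : Fin l) (h' : s.card = k + j') : j' = j := Fin.ext (by omega)
      have hT : layerTemplate n k T s = T j := by
        ext i
        simp only [layerTemplate, Finset.mem_filter, Finset.mem_univ, true_and]
        exact ⟨fun ⟨j', h', hi⟩ => huniq j' h' ▸ hi, fun hi => ⟨j, hj, hi⟩⟩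
      rw [hT, Finset.sum_eq_single j, if_pos hj]
      · intro j' _ hne
        exact if_neg fun h' => hne (huniq j' h')
      · simp
    · have hT : layerTemplate n k T s = ∅ := by
        simp only [layerTemplate, Finset.filter_eq_empty_iff]
        rintro i - ⟨j, hj, -⟩
        exact h ⟨j, hj⟩
      rw [hT, Finset.sum_empty, add_zero, Real.log_one]
      exact (Finset.sum_eq_zero fun j _ => if_neg fun hj => h ⟨j, hj⟩).symm
  rw [Template.weight, Finset.sum_congr rfl fun s _ => h₁ s, Finset.sum_comm]
  refine Finset.sum_congr rfl fun j _ => ?_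
  rw [← Finset.sum_filter, Finset.sum_const, nsmul_eq_mul]
  congr 2
  rw [← Finset.powerset_univ, ← Finset.powersetCard_eq_filter, Finset.card_powersetCard,
    Finset.card_univ, Fintype.card_fin]

theorem sum_le_log_partitionSum (hp : ∀ i, 0 ≤ p i) (k : ℕ) {l : ℕ} {T : Template (Fin l) m}
    (hT : T.IsValid G) :
    ∑ j : Fin l, (n.choose (k + j) : ℝ) * Real.log (1 + ∑ i ∈ T j, p i) ≤
      Real.log (partitionSum G p (Finset (Fin n))) := by
  have h := exp_weight_le_partitionSum hp (isValid_layerTemplate (n := n) k hT)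
  rw [weight_layerTemplate] at h
  exact (Real.le_log_iff_exp_le ((Real.exp_pos _).trans_le h)).2 h

end LowerBound

/-! ### The expectation as a partition sum -/

section Expectation

variable {P Ω : Type*} [Fintype P] [MeasurableSpace Ω] {m : ℕ} {G : Finset (List (Fin m))}
  {p : Fin m → ℝ}

-- A set of colored points corresponds to its inherited coloring, with the support as inverse. The
-- summation range no longer depends on `χ`, which prepares linearity of expectation.
open Classical in
theorem numValid_eq_card [Preorder P] (χ : P → Option (Fin m)) :
    numValid G χ = (Finset.univ.filter fun c : ColoredSubset P m =>
      IsValid G c ∧ ∀ x, c x ≠ none → χ x = c x).card := by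
  rw [numValid, ← Set.ncard_coe_finset]
  refine Set.ncard_congr (fun S _ => restrict χ S) ?_ ?_ ?_
  · rintro S ⟨hS, hv⟩
    simp only [Finset.coe_filter, Finset.mem_univ, true_and, Set.mem_ofPred_eq]
    refine ⟨hv, fun x hx => ?_⟩
    rw [restrict] at hx ⊢
    split_ifs at hx ⊢ with h
    · rfl
    · exact absurd rfl hx
  · rintro S S' ⟨hS, -⟩ ⟨hS', -⟩ h
    ext x
    have hx := congrFun h x
    simp only [restrict] at hx
    by_cases h₁ : x ∈ S <;> by_cases h₂ : x ∈ S' <;> simp only [h₁, h₂, if_true, if_false] at hx ⊢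
    · exact absurd hx (hS x h₁)
    · exact absurd hx.symm (hS' x h₂)
  · intro c hc
    simp only [Finset.coe_filter, Finset.mem_univ, true_and, Set.mem_ofPred_eq] at hc
    have hr : restrict χ {x | c x ≠ none} = c := by
      funext x
      by_cases h : c x = none
      · simp [restrict, h]
      · simp only [restrict, Set.mem_ofPred_eq]
        rw [if_pos h, hc.2 x h]
    refine ⟨{x | c x ≠ none}, ⟨fun x hx => ?_, ?_⟩, hr⟩
    · rw [hc.2 x hx]
      exact hx
    · rw [hr]
      exact hc.1

theorem measureReal_forall_eq {μ : Measure Ω} [IsProbabilityMeasure μ]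
    {χ : P → Ω → Option (Fin m)} (hp : ∀ i, 0 ≤ p i) (hχ : IsRandomColoring p μ χ)
    (c : ColoredSubset P m) :
    μ.real {ω | ∀ x, c x ≠ none → χ x ω = c x} = ∏ x, (c x).elim 1 p := by
  classical
  have hset : {ω | ∀ x, c x ≠ none → χ x ω = c x} =
      ⋂ x ∈ Finset.univ.filter fun x => c x ≠ none, χ x ⁻¹' {c x} := by
    ext ω
    simp
  rw [Measure.real, hset, (iIndepFun_iff_measure_inter_preimage_eq_mul.1 hχ.indep)
    (Finset.univ.filter fun x => c x ≠ none) (sets := fun x => {c x})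
    (fun x _ => trivial), Finset.prod_filter, ENNReal.toReal_prod]
  refine Finset.prod_congr rfl fun x _ => ?_
  cases hx : c x with
  | none => simp
  | some i =>
    have h := hχ.prob x i
    have h' : χ x ⁻¹' {some i} = {ω | χ x ω = some i} := rfl
    simp [h', h, hp i]

theorem integral_numValid [Preorder P] {μ : Measure Ω} [IsProbabilityMeasure μ]
    {χ : P → Ω → Option (Fin m)} (hp : ∀ i, 0 ≤ p i) (hχ : IsRandomColoring p μ χ) :
    ∫ ω, (numValid G (fun x => χ x ω) : ℝ) ∂μ = partitionSum G p P := by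
  classical
  have hmeas (c : ColoredSubset P m) : MeasurableSet {ω | ∀ x, c x ≠ none → χ x ω = c x} := by
    have hset : {ω | ∀ x, c x ≠ none → χ x ω = c x} =
        ⋂ x ∈ Finset.univ.filter fun x => c x ≠ none, χ x ⁻¹' {c x} := by
      ext ω
      simp
    rw [hset]
    exact Finset.measurableSet_biInter _ fun x _ => hχ.measurable x trivial
  have h₁ (ω : Ω) : (numValid G (fun x => χ x ω) : ℝ) =
      ∑ c : ColoredSubset P m with IsValid G c,
        Set.indicator {ω | ∀ x, c x ≠ none → χ x ω = c x} (fun _ => (1 : ℝ)) ω := by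
    rw [numValid_eq_card, ← Finset.filter_filter, Finset.card_filter, Nat.cast_sum]
    refine Finset.sum_congr rfl fun c _ => ?_
    rw [Set.indicator_apply]
    simp
  simp_rw [h₁]
  rw [integral_finsetSum, partitionSum]
  · refine Finset.sum_congr rfl fun c _ => ?_
    rw [integral_indicator_const _ (hmeas c), measureReal_forall_eq hp hχ]
    simp
  · intro c _
    exact (integrable_const _).indicator (hmeas c)

end Expectation

/-! ### Binomial estimates -/

section Binomials

/-- By the recursion for central binomials, the induction step reduces to 4k(k + 1) ≤ (2k + 1)². -/
theorem sixteen_pow_le (k : ℕ) (hk : 0 < k) : 16 ^ k ≤ 4 * k * k.centralBinom ^ 2 := by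
  induction k, hk using Nat.le_induction with
  | base => decide
  | succ k hk ih =>
    have h := Nat.succ_mul_centralBinom_succ k
    refine le_of_mul_le_mul_left ?_ (Nat.succ_pos k)
    calc (k + 1) * 16 ^ (k + 1) = 16 * (k + 1) * 16 ^ k := by ring
      _ ≤ 16 * (k + 1) * (4 * k * k.centralBinom ^ 2) := Nat.mul_le_mul_left _ ih
      _ ≤ 4 * (2 * (2 * k + 1) * k.centralBinom) ^ 2 := by
        nlinarith [sq_nonneg k.centralBinom]
      _ = 4 * ((k + 1) * (k + 1).centralBinom) ^ 2 := by rw [h]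
      _ = (k + 1) * (4 * (k + 1) * (k + 1).centralBinom ^ 2) := by ring

theorem four_pow_le (n : ℕ) (hn : 0 < n) : 4 ^ n ≤ 4 * n * n.choose (n / 2) ^ 2 := by
  obtain ⟨k, rfl | rfl⟩ := Nat.even_or_odd' n
  · have h := sixteen_pow_le k (by omega)
    rw [Nat.centralBinom_eq_two_mul_choose] at h
    rw [Nat.mul_div_cancel_left _ two_pos, pow_mul]
    norm_num
    nlinarith [Nat.zero_le (k * ((2 * k).choose k) ^ 2)]
  · have h := sixteen_pow_le (k + 1) (by omega)
    have h₂ : (k + 1).centralBinom = 2 * (2 * k + 1).choose k := by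
      rw [Nat.centralBinom_eq_two_mul_choose, show 2 * (k + 1) = 2 * k + 1 + 1 by ring,
        Nat.choose_succ_succ', ← Nat.choose_symm_half]
      ring
    rw [h₂] at h
    rw [show (2 * k + 1) / 2 = k by omega]
    have h₃ : 16 ^ (k + 1) = 4 * 4 ^ (2 * k + 1) := by
      rw [show (16 : ℕ) = 4 ^ 2 by norm_num, ← pow_mul]
      ring
    rw [h₃] at h
    nlinarith [Nat.zero_le (k * ((2 * k + 1).choose k) ^ 2)]

theorem two_pow_le (n : ℕ) (hn : 0 < n) :
    (2 : ℝ) ^ n ≤ 2 * √n * (n.choose (n / 2) : ℝ) := by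
  have h : (4 : ℝ) ^ n ≤ 4 * n * (n.choose (n / 2) : ℝ) ^ 2 := by exact_mod_cast four_pow_le n hn
  refine le_of_sq_le_sq ?_ (by positivity)
  rw [← pow_mul, mul_comm n 2, pow_mul, mul_pow, mul_pow, Real.sq_sqrt (by positivity)]
  norm_num
  exact h

/-- The variance of a binomial variable with parameter 1/2, read off from Bernstein polynomials. -/
theorem sum_choose_mul_sq (n : ℕ) :
    ∑ k ∈ Finset.range (n + 1), (n.choose k : ℝ) * ((n : ℝ) - 2 * (k : ℝ)) ^ 2 = (n : ℝ) * 2 ^ n := by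
  have h := congrArg (Polynomial.eval (1 / 2 : ℝ)) (bernsteinPolynomial.variance ℝ n)
  simp only [Polynomial.eval_finsetSum, bernsteinPolynomial] at h
  simp only [Polynomial.eval_mul, Polynomial.eval_pow, Polynomial.eval_sub,
    Polynomial.eval_X, Polynomial.eval_natCast, Polynomial.eval_one, nsmul_eq_mul] at h
  have h₂ : ∀ k ∈ Finset.range (n + 1), (n.choose k : ℝ) * ((n : ℝ) - 2 * (k : ℝ)) ^ 2 =
      4 * 2 ^ n * (((n : ℝ) * (1 / 2) - k) ^ 2 * (n.choose k * (1 / 2) ^ k * (1 - 1 / 2) ^ (n - k))) := by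
    intro k hk
    have hk' : (2 : ℝ) ^ n * ((1 / 2) ^ k * (1 - 1 / 2) ^ (n - k)) = 1 := by
      rw [show (1 - 1 / 2 : ℝ) = 1 / 2 by norm_num, ← pow_add,
        Nat.add_sub_cancel' (Nat.lt_succ_iff.1 (Finset.mem_range.1 hk)), ← mul_pow]
      norm_num
    linear_combination (-(n.choose k : ℝ) * (n - 2 * k) ^ 2) * hk'
  rw [Finset.sum_congr rfl h₂, ← Finset.mul_sum, h]
  ring

/-- Chebyshev's inequality. This polynomial saving suffices, because 2^n is only O(√n) times the
middle coefficient. -/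
theorem card_compl_lowerSets_le (n : ℕ) (hn : 0 < n) :
    ((lowerSets n)ᶜ.card : ℝ) ≤ 4 * 2 ^ n / n := by
  have h₁ : ∑ s : Finset (Fin n), ((n : ℝ) - 2 * (s.card : ℝ)) ^ 2 = (n : ℝ) * 2 ^ n := by
    rw [← sum_choose_mul_sq, ← Finset.powerset_univ,
      Finset.sum_powerset_apply_card (fun k => ((n : ℝ) - 2 * k) ^ 2)]
    simp
  have h₂ : ((lowerSets n)ᶜ.card : ℝ) * (n / 2) ^ 2 ≤ n * 2 ^ n := by
    rw [← h₁, ← nsmul_eq_mul]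
    refine (Finset.card_nsmul_le_sum _ (fun s => ((n : ℝ) - 2 * s.card) ^ 2) _ ?_).trans
      (Finset.sum_le_sum_of_subset_of_nonneg (Finset.subset_univ _) fun _ _ _ => sq_nonneg _)
    intro s hs
    have hs' : 3 * n < 4 * s.card := by simpa [lowerSets] using hs
    have hs'' : 3 * (n : ℝ) < 4 * s.card := by exact_mod_cast hs'
    have hn' : (0 : ℝ) ≤ n := Nat.cast_nonneg _
    nlinarith
  have hn' : (0 : ℝ) < n := by exact_mod_cast hn
  rw [le_div_iff₀ hn']
  refine le_of_mul_le_mul_right ?_ hn'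
  linarith

/-- Consecutive coefficients have ratio (n - (n/2 + j)) / (n/2 + j + 1), which tends to 1 for fixed
j. -/
theorem tendsto_choose_div_choose (j : ℕ) :
    Tendsto (fun n : ℕ => (n.choose (n / 2 + j) : ℝ) / n.choose (n / 2)) atTop (𝓝 1) := by
  induction j with
  | zero =>
    refine tendsto_const_nhds.congr fun n => ?_
    have : (n.choose (n / 2) : ℝ) ≠ 0 := by
      exact_mod_cast (Nat.choose_pos (Nat.div_le_self n 2)).ne'
    rw [add_zero, div_self this]
  | succ j ih =>
    have hratio : Tendsto (fun n : ℕ => ((n - (n / 2 + j) : ℕ) : ℝ) / (n / 2 + j + 1 : ℕ)) atTop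
        (𝓝 1) := by
      have h0 : Tendsto (fun n : ℕ => (2 * (j : ℝ) + 2) / (n / 2 + j + 1 : ℕ)) atTop (𝓝 0) := by
        refine Tendsto.div_atTop tendsto_const_nhds (tendsto_natCast_atTop_atTop.comp ?_)
        exact tendsto_atTop_mono (fun n => by omega)
          (Nat.tendsto_div_const_atTop (two_ne_zero))
      have hlow : Tendsto (fun n : ℕ => 1 - (2 * (j : ℝ) + 2) / (n / 2 + j + 1 : ℕ)) atTop
          (𝓝 1) := by
        simpa using tendsto_const_nhds.sub h0
      refine tendsto_of_tendsto_of_tendsto_of_le_of_le hlow tendsto_const_nhds ?_ ?_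
      · intro n
        have hpos : (0 : ℝ) < (n / 2 + j + 1 : ℕ) := by positivity
        change _ ≤ _ / _
        rw [le_div_iff₀ hpos, sub_mul, div_mul_cancel₀ _ hpos.ne', one_mul, sub_le_iff_le_add]
        have : n / 2 + j + 1 ≤ n - (n / 2 + j) + (2 * j + 2) := by omega
        exact_mod_cast this
      · intro n
        have hpos : (0 : ℝ) < (n / 2 + j + 1 : ℕ) := by positivity
        change _ / _ ≤ _
        rw [div_le_one hpos]
        exact_mod_cast (show n - (n / 2 + j) ≤ n / 2 + j + 1 by omega)
    have := ih.mul hratio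
    rw [mul_one] at this
    refine this.congr fun n => ?_
    have hpos : ((n / 2 + j + 1 : ℕ) : ℝ) ≠ 0 := by positivity
    have hs : (n.choose (n / 2 + j + 1) : ℝ) * (n / 2 + j + 1 : ℕ) =
        n.choose (n / 2 + j) * (n - (n / 2 + j) : ℕ) := by
      exact_mod_cast Nat.choose_succ_right_eq n (n / 2 + j)
    rw [← add_assoc, div_mul_div_comm, ← hs, mul_div_mul_right _ _ hpos]

end Binomials

/-! ### Choice of the degree bound and the limit -/

section Asymptotics

variable {m : ℕ} {G : Finset (List (Fin m))} {p : Fin m → ℝ}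

/-- The degree bound used in the container lemma. -/
noncomputable def degreeBound (n : ℕ) : ℕ := ⌈(n : ℝ) ^ (3 / 4 : ℝ)⌉₊

theorem tendsto_degreeBound_div : Tendsto (fun n : ℕ => (degreeBound n : ℝ) / n) atTop (𝓝 0) := by
  have h₁ : Tendsto (fun n : ℕ => (n : ℝ) ^ (-(1 / 4) : ℝ) + 1 / n) atTop (𝓝 0) := by
    simpa using ((tendsto_rpow_neg_atTop (show (0 : ℝ) < 1 / 4 by norm_num)).comp
      tendsto_natCast_atTop_atTop).add tendsto_one_div_atTop_nhds_zero_nat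
  refine squeeze_zero' (Eventually.of_forall fun n => by positivity) ?_ h₁
  filter_upwards [eventually_gt_atTop 0] with n hn
  have hn' : (0 : ℝ) < n := by exact_mod_cast hn
  have h₂ : (degreeBound n : ℝ) ≤ (n : ℝ) ^ (3 / 4 : ℝ) + 1 :=
    (Nat.ceil_lt_add_one (by positivity)).le
  have h₃ : (n : ℝ) ^ (-(1 / 4) : ℝ) = (n : ℝ) ^ (3 / 4 : ℝ) / n := by
    rw [show (-(1 / 4) : ℝ) = 3 / 4 - 1 by norm_num, Real.rpow_sub_one hn'.ne']
  rw [h₃, ← add_div]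
  gcongr

theorem tendsto_log_mul_rpow :
    Tendsto (fun n : ℕ => (2 + Real.log n) * (n : ℝ) ^ (-(1 / 4) : ℝ)) atTop (𝓝 0) := by
  have h₁ : Tendsto (fun x : ℝ => 2 * x ^ (-(1 / 4) : ℝ) + Real.log x / x ^ (1 / 4 : ℝ)) atTop
      (𝓝 0) := by
    have := ((tendsto_rpow_neg_atTop (show (0 : ℝ) < 1 / 4 by norm_num)).const_mul 2).add
      (isLittleO_log_rpow_atTop (show (0 : ℝ) < 1 / 4 by norm_num)).tendsto_div_nhds_zero
    simpa using this
  refine (h₁.comp tendsto_natCast_atTop_atTop).congr fun n => ?_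
  simp only [Function.comp]
  rw [Real.rpow_neg (Nat.cast_nonneg n)]
  ring

/-- The error terms come from conflicts, fingerprints and large sets. As 2^n = O(√n N), the exponent
3/4 in `degreeBound` works: below 1 for the conflicts, above 1/2 for the fingerprints. -/
theorem log_partitionSum_div_le (hG : ∀ g ∈ G, 2 ≤ g.length) (h : IsSparse G)
    (hp : ∀ i, 0 ≤ p i) (hp1 : ∑ i, p i ≤ 1) {n : ℕ} (hn : 0 < n)
    (hdn : 8 * degreeBound n ≤ n) :
    Real.log (partitionSum G p (Finset (Fin n))) / n.choose (n / 2) ≤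
      omegaCrit G p + 8 * ((states G).card * chainBound h : ℕ) * (degreeBound n / n) +
        2 * (states G).card * ((2 + Real.log n) * (n : ℝ) ^ (-(1 / 4) : ℝ)) +
        8 * (n : ℝ) ^ (-(1 / 2) : ℝ) := by
  have hn' : (0 : ℝ) < n := by exact_mod_cast hn
  have hn1 : (1 : ℝ) ≤ n := by exact_mod_cast hn
  set d := degreeBound n
  set N : ℝ := (n.choose (n / 2) : ℝ) with hN
  have hNpos : 0 < N := by
    rw [hN]
    exact_mod_cast Nat.choose_pos (Nat.div_le_self n 2)
  have hdpos : 0 < d := Nat.ceil_pos.2 (by positivity)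
  have hdpos' : (0 : ℝ) < d := by exact_mod_cast hdpos
  have hdle : (n : ℝ) ^ (3 / 4 : ℝ) ≤ d := Nat.le_ceil _
  have h₁ := partitionSum_le hG h hp hp1 hdpos hdn
  have h2 := two_pow_le n hn
  have hsqrt : √(n : ℝ) = (n : ℝ) ^ (1 / 2 : ℝ) := Real.sqrt_eq_rpow _
  have hlog : Real.log d ≤ Real.log n := by
    refine Real.log_le_log hdpos' ?_
    exact_mod_cast (show d ≤ n by omega)
  have hlogn := Real.log_nonneg hn1
  have h₃ : (2 : ℝ) ^ n / d ≤ 2 * (n : ℝ) ^ (-(1 / 4) : ℝ) * N := by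
    rw [div_le_iff₀ hdpos']
    calc (2 : ℝ) ^ n ≤ 2 * √n * N := h2
      _ = 2 * (n : ℝ) ^ (-(1 / 4) : ℝ) * N * (n : ℝ) ^ (3 / 4 : ℝ) := by
        rw [hsqrt, show (1 / 2 : ℝ) = -(1 / 4) + 3 / 4 by norm_num, Real.rpow_add hn']
        ring
      _ ≤ _ := by gcongr
  have h₄ : (2 + Real.log d) * ((states G).card * 2 ^ n / d) ≤
      2 * (states G).card * ((2 + Real.log n) * (n : ℝ) ^ (-(1 / 4) : ℝ)) * N := by
    calc _ ≤ (2 + Real.log n) * ((states G).card * (2 ^ n / d)) := by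
          rw [mul_div_assoc]
          gcongr
      _ ≤ (2 + Real.log n) * ((states G).card * (2 * (n : ℝ) ^ (-(1 / 4) : ℝ) * N)) := by
          gcongr
      _ = _ := by ring
  have h₅ : ((lowerSets n)ᶜ.card : ℝ) ≤ 8 * (n : ℝ) ^ (-(1 / 2) : ℝ) * N := by
    refine (card_compl_lowerSets_le n hn).trans ?_
    rw [div_le_iff₀ hn']
    calc 4 * (2 : ℝ) ^ n ≤ 4 * (2 * √n * N) := by gcongr
      _ = 8 * (n : ℝ) ^ (-(1 / 2) : ℝ) * N * n := by
        have : (n : ℝ) ^ (1 / 2 : ℝ) = (n : ℝ) ^ (-(1 / 2) : ℝ) * n := by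
          conv_rhs => rw [← Real.rpow_add_one hn'.ne']
          norm_num
        rw [hsqrt, this]
        ring
  rw [div_le_iff₀ hNpos]
  refine h₁.trans ((add_le_add (add_le_add le_rfl h₄) h₅).trans (le_of_eq ?_))
  ring

theorem tendsto_log_partitionSum_div (hG : ∀ g ∈ G, 2 ≤ g.length) (h : IsSparse G)
    (hp : ∀ i, 0 ≤ p i) (hp1 : ∑ i, p i ≤ 1) :
    Tendsto (fun n : ℕ => Real.log (partitionSum G p (Finset (Fin n))) / n.choose (n / 2)) atTop
      (𝓝 (omegaCrit G p)) := by
  obtain ⟨l, T, hT, hw⟩ := (isGreatest_omegaCrit hG h p).1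
  have hlow : Tendsto (fun n : ℕ => ∑ j : Fin l, (n.choose (n / 2 + j) : ℝ) / n.choose (n / 2) *
      Real.log (1 + ∑ i ∈ T j, p i)) atTop (𝓝 (omegaCrit G p)) := by
    rw [← hw, Template.weight]
    refine tendsto_finsetSum _ fun j _ => ?_
    simpa using (tendsto_choose_div_choose j).mul_const (Real.log (1 + ∑ i ∈ T j, p i))
  have hup : Tendsto (fun n : ℕ => omegaCrit G p +
        8 * ((states G).card * chainBound h : ℕ) * (degreeBound n / n : ℝ) +
        2 * (states G).card * ((2 + Real.log n) * (n : ℝ) ^ (-(1 / 4) : ℝ)) +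
        8 * (n : ℝ) ^ (-(1 / 2) : ℝ)) atTop (𝓝 (omegaCrit G p)) := by
    have h₁ := ((tendsto_rpow_neg_atTop (show (0 : ℝ) < 1 / 2 by norm_num)).comp
      tendsto_natCast_atTop_atTop).const_mul (8 : ℝ)
    have h₂ := tendsto_log_mul_rpow.const_mul (2 * (states G).card : ℝ)
    have h₃ := tendsto_degreeBound_div.const_mul
      (8 * ((states G).card * chainBound h : ℕ) : ℝ)
    simpa using (((tendsto_const_nhds (x := omegaCrit G p)).add h₃).add h₂).add h₁
  refine tendsto_of_tendsto_of_tendsto_of_le_of_le' hlow hup (Eventually.of_forall fun n => ?_) ?_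
  · have hNpos : (0 : ℝ) < n.choose (n / 2) := by
      exact_mod_cast Nat.choose_pos (Nat.div_le_self n 2)
    rw [le_div_iff₀ hNpos, Finset.sum_mul]
    refine le_trans (le_of_eq (Finset.sum_congr rfl fun j _ => ?_))
      (sum_le_log_partitionSum hp (n / 2) hT)
    field_simp
  · have h8 := tendsto_degreeBound_div.eventually_lt_const (show (0 : ℝ) < 1 / 8 by norm_num)
    filter_upwards [eventually_gt_atTop 0, h8] with n hn h8
    refine log_partitionSum_div_le hG h hp hp1 hn ?_
    have hn' : (0 : ℝ) < n := by exact_mod_cast hn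
    rw [div_lt_iff₀ hn'] at h8
    have : (8 * degreeBound n : ℝ) ≤ n := by linarith
    exact_mod_cast this

/-- On a single point every template is valid, since forbidden chains have at least two elements;
hence log (1 + p i) ≤ 0. -/
theorem eq_zero_of_omegaCrit_eq_zero (hG : ∀ g ∈ G, 2 ≤ g.length) (h : IsSparse G)
    (hp : ∀ i, 0 ≤ p i) (h0 : omegaCrit G p = 0) (i : Fin m) : p i = 0 := by
  have hT : Template.IsValid G (fun _ : Fin 1 => ({i} : Finset (Fin m))) := by
    rw [Template.isValid_iff]
    rintro g hg ⟨x, hx, -⟩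
    have hlen := hG g hg
    have := hx (show (⟨0, by omega⟩ : Fin g.length) < ⟨1, by omega⟩ by simp)
    exact this.ne (Subsingleton.elim _ _)
  have h₁ := (isGreatest_omegaCrit hG h p).2 ⟨1, _, hT, rfl⟩
  simp only [Template.weight, Finset.sum_singleton, Finset.univ_unique, h0] at h₁
  by_contra hne
  have hpos := lt_of_le_of_ne (hp i) (Ne.symm hne)
  exact absurd (Real.log_pos (show 1 < 1 + p i by linarith)) (not_lt.2 h₁)

theorem partitionSum_eq_one {P : Type*} [Fintype P] [Preorder P] (hG : ∀ g ∈ G, 2 ≤ g.length)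
    (hp : ∀ i, p i = 0) : partitionSum G p P = 1 := by
  have hp' (i) : 0 ≤ p i := (hp i).ge
  refine le_antisymm ?_ (one_le_partitionSum hG hp')
  have := partitionSum_le_sum (G := G) (P := P) hp' {()} (fun _ _ => Finset.univ)
    fun c _ => ⟨(), by simp⟩
  simpa [Template.weight, hp] using this

end Asymptotics

end ColoredChains

theorem mainTheorem3 (m : ℕ) (G : Finset (List (Fin m))) (hG : ∀ g ∈ G, 2 ≤ g.length)
    (hsparse : ColoredChains.IsSparse G) (p : Fin m → ℝ) (hp : ∀ i, 0 ≤ p i) (hp1 : ∑ i, p i ≤ 1) :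
    IsGreatest (ColoredChains.chainWeights G p) (ColoredChains.omegaCrit G p) ∧
    ∃ ε : ℕ → ℝ, Tendsto ε atTop (𝓝 0) ∧
      ∀ (n : ℕ) (Ω : Type*) [MeasurableSpace Ω] (μ : Measure Ω) [IsProbabilityMeasure μ]
        (χ : Finset (Fin n) → Ω → Option (Fin m)), ColoredChains.IsRandomColoring p μ χ →
        ∫ ω, (ColoredChains.numValid G (fun x => χ x ω) : ℝ) ∂μ
          = Real.exp (ColoredChains.omegaCrit G p * (n.choose (n / 2) : ℝ) * (1 + ε n)) := by
  refine ⟨ColoredChains.isGreatest_omegaCrit hG hsparse p, ?_⟩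
  -- A relative error requires division by `omegaCrit`. If it vanishes, all `p i` are 0 and the
  -- expectation is exactly 1.
  by_cases h0 : ColoredChains.omegaCrit G p = 0
  · refine ⟨fun _ => 0, tendsto_const_nhds, fun n Ω _ μ _ χ hχ => ?_⟩
    rw [ColoredChains.integral_numValid hp hχ, ColoredChains.partitionSum_eq_one hG
      (ColoredChains.eq_zero_of_omegaCrit_eq_zero hG hsparse hp h0), h0]
    simp
  · refine ⟨fun n => Real.log (ColoredChains.partitionSum G p (Finset (Fin n))) /
      n.choose (n / 2) / ColoredChains.omegaCrit G p - 1, ?_, fun n Ω _ μ _ χ hχ => ?_⟩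
    · have := ((ColoredChains.tendsto_log_partitionSum_div hG hsparse hp hp1).div_const
        (ColoredChains.omegaCrit G p)).sub_const 1
      rwa [div_self h0, sub_self] at this
    · have hN : (n.choose (n / 2) : ℝ) ≠ 0 := by
        exact_mod_cast (Nat.choose_pos (Nat.div_le_self n 2)).ne'
      have hZ := zero_lt_one.trans_le
        (ColoredChains.one_le_partitionSum (P := Finset (Fin n)) hG hp)
      rw [ColoredChains.integral_numValid hp hχ, add_sub_cancel, div_div,
        mul_comm (n.choose (n / 2) : ℝ), mul_div_cancel₀ _ (mul_ne_zero h0 hN),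
        Real.exp_log hZ]
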